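/- Let $0\le k\le n$ be integers with $n\ge 1$, and let $\mathrm{Gr}(k,n)$ be the Grassmannian of $k$-dimensional subspaces of $\mathbb C^n$ with its Zariski topology. For $S\subseteq[n]=\{1,\dots,n\}$ let $\mathrm{Project}_S:\mathbb C^n\to\mathbb C^S$ be the coordinate projection. For $V\in\mathrm{Gr}(k,n)$ and $i,j\in\mathbb Z$ put $r_{ij}(V)=j-i+1$ if $j<i$, and $r_{ij}(V)=\dim\mathrm{Project}_{\{i,i+1,\dots,j\}}(V)$ (indices modulo $n$) if $i\le j$. Let $\mathrm{Bound}(k,n)$ be the set of bijections $f:\mathbb Z\to\mathbb Z$ with $f(i+n)=f(i)+n$ and $i\le f(i)\le i+n$ for all $i$, and $\frac1n\sum_{i=1}^n(f(i)-i)=k$. It is partially ordered by the restriction $\le$ of the Bruhat order on affine permutations, i.e. the reflexive transitive closure of the relations $f<ft$, where $t$ is a reflection (for some $i\not\equiv j \bmod n$, $t$ exchanges $i+rn$ and $j+rn$ for all $r\in\mathbb Z$ and fixes all other integers) and $\ell(f)<\ell(ft)$; here $\ell(f)$ is the number of inversions of $f$ (pairs $i<j$ with $f(i)>f(j)$) modulo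 simultaneous translation by multiples of $n$. For $f\in\mathrm{Bound}(k,n)$ and $t\in\mathbb Z$ let $\mathrm{st}(f,t)=\{f(i)-t: i\le t\}$, let $J_i=\mathrm{st}(f,i-1)\cap[n]$ for $1\le i\le n$, and let $r_{ij}(f)=k-\#\{x\in\mathrm{st}(f,i-1): x>j-i+1\}$ for $i,j\in\mathbb Z$. The open positroid variety of $f$ is $$\mathring\Pi_f=\{V\in\mathrm{Gr}(k,n): r_{ij}(V)=r_{ij}(f)\text{ for all } i,j\in\mathbb Z\},$$ and the positroid variety $\Pi_f$ is the closure of $\mathring\Pi_f$. For $I\subseteq[n]$ with $|I|=k$ let $X_I=\{V\in\mathrm{Gr}(k,n):\dim\mathrm{Project}_{[j]}(V)\le\#(I\cap[j])\text{ for all }0\le j\le n\}$ be the Schubert variety, and let $\chi$ act on $\mathrm{Gr}(k,n)$ through the cyclic shift $e_1\mapsto e_2\mapsto\cdots\mapsto e_n\mapsto e_1$ of the standard basis. **Theorem.** The open positroid varieties $\mathring\Pi_f$, $f\in\mathrm{Bound}(k,n)$, form a stratification of $\mathrm{Gr}(k,n)$: they are finitely many nonempty, pairwise disjoint, locally closed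 subsets that cover $\mathrm{Gr}(k,n)$, and the closure of each of them is a union of some of them. Moreover, for every $f\in\mathrm{Bound}(k,n)$, $$\Pi_f=\coprod_{f'\ge f}\mathring\Pi_{f'}=X_{J_1}\cap\chi(X_{J_2})\cap\cdots\cap\chi^{n-1}(X_{J_n}),$$ where $f'$ ranges over the elements of $\mathrm{Bound}(k,n)$ with $f'\ge f$, and $J_1,\dots,J_n$ are the sets associated with $f$ above. -/

import Mathlib

namespace Positroid

noncomputable section

/-! Throughout, `c : Fin n` stands for the element `c + 1` of `[n] = {1, …, n}`. -/

/-! ### The Grassmannian with its Zariski topology -/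

/-- `Gr(k,n)`: the `k`-dimensional linear subspaces of `ℂⁿ`. -/
def Gr (k n : ℕ) : Type := {V : Submodule ℂ (Fin n → ℂ) // Module.finrank ℂ V = k}

/-- A `k × n` matrix whose rows form a (chosen) basis of `V`. -/
def basisMatrix {k n : ℕ} (V : Gr k n) : Matrix (Fin k) (Fin n) ℂ :=
  Matrix.of fun r c => (Module.finBasisOfFinrankEq ℂ V.1 V.2 r : Fin n → ℂ) c

/-- The Plücker coordinates of `V`, indexed by the `k`-element subsets of `[n]` (written as
increasing maps `Fin k → Fin n`). Another basis of `V` multiplies all of them by one common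
nonzero scalar. -/
def pluckerCoord {k n : ℕ} (V : Gr k n) (I : Fin k ↪o Fin n) : ℂ :=
  ((basisMatrix V).submatrix id I).det

/-- The homogeneous polynomials in the Plücker coordinates. -/
def homogeneousPolys (k n : ℕ) : Set (MvPolynomial (Fin k ↪o Fin n) ℂ) :=
  {p | ∃ d : ℕ, p.IsHomogeneous d}

/-- The common zero locus in `Gr(k,n)` of a set of polynomials in the Plücker coordinates. -/
def zeroLocus {k n : ℕ} (T : Set (MvPolynomial (Fin k ↪o Fin n) ℂ)) : Set (Gr k n) :=
  {V | ∀ p ∈ T, MvPolynomial.eval (pluckerCoord V) p = 0}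

/-- The Zariski topology of `Gr(k,n)`: the closed sets are the common zero loci of homogeneous
polynomials in the Plücker coordinates. -/
instance zariskiTopology (k n : ℕ) : TopologicalSpace (Gr k n) :=
  TopologicalSpace.ofClosed {Z | ∃ T ⊆ homogeneousPolys k n, Z = zeroLocus T}
    (by
      refine ⟨{1}, ?_, ?_⟩
      · rintro p rfl
        exact ⟨0, MvPolynomial.isHomogeneous_one _ _⟩
      · ext V
        simp [zeroLocus])
    (by
      intro A hA
      have hA' : ∀ Z : Set (Gr k n), Z ∈ A → ∃ T ⊆ homogeneousPolys k n, Z = zeroLocus T :=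
        fun Z hZ => hA hZ
      choose! T hT hZ using hA'
      refine ⟨⋃ Z ∈ A, T Z, ?_, ?_⟩
      · intro p hp
        simp only [Set.mem_iUnion] at hp
        obtain ⟨Z, hZA, hpZ⟩ := hp
        exact hT Z hZA hpZ
      · ext V
        simp only [Set.mem_sInter, zeroLocus, Set.mem_iUnion, Set.mem_ofPred_eq]
        constructor
        · rintro h p ⟨Z, hZA, hpZ⟩
          have hV := h Z hZA
          rw [hZ Z hZA] at hV
          exact hV p hpZ
        · intro h Z hZA
          rw [hZ Z hZA]
          exact fun p hp => h p ⟨Z, hZA, hp⟩)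
    (by
      rintro _ ⟨S, hS, rfl⟩ _ ⟨T, hT, rfl⟩
      refine ⟨{p | ∃ s ∈ S, ∃ t ∈ T, p = s * t}, ?_, ?_⟩
      · rintro _ ⟨s, hs, t, ht, rfl⟩
        obtain ⟨d, hd⟩ := hS hs
        obtain ⟨e, he⟩ := hT ht
        exact ⟨d + e, hd.mul he⟩
      · ext V
        simp only [Set.mem_union, zeroLocus, Set.mem_ofPred_eq]
        constructor
        · rintro (h | h) _ ⟨s, hs, t, ht, rfl⟩
          · simp [h s hs]
          · simp [h t ht]
        · intro h
          by_contra! hc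
          obtain ⟨⟨s, hs, hs0⟩, ⟨t, ht, ht0⟩⟩ := hc
          have := h _ ⟨s, hs, t, ht, rfl⟩
          rw [map_mul] at this
          exact (mul_ne_zero hs0 ht0) this)

/-- `dim Project_S(V)`, where `Project_S : ℂⁿ → ℂ^S` is the coordinate projection. -/
def projDim {k n : ℕ} (S : Set (Fin n)) (V : Gr k n) : ℕ :=
  Module.finrank ℂ (V.1.map (LinearMap.funLeft ℂ ℂ (Subtype.val : S → Fin n)))

/-- The action of a permutation of `[n]` on `Gr(k,n)`, induced by `e_c ↦ e_{σ(c)}`, that is,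
`(σ v)_c = v_{σ⁻¹(c)}`. -/
def permAct {k n : ℕ} (σ : Equiv.Perm (Fin n)) (V : Gr k n) : Gr k n :=
  ⟨V.1.map (LinearEquiv.funCongrLeft ℂ ℂ σ.symm).toLinearMap,
    (LinearEquiv.finrank_map_eq (LinearEquiv.funCongrLeft ℂ ℂ σ.symm) V.1).trans V.2⟩

/-- The long cycle `χ = [2 3 ⋯ n 1]`. -/
def chi (n : ℕ) : Equiv.Perm (Fin n) := finRotate n

/-- The Schubert variety `X_I = {V | dim Project_{[j]}(V) ≤ #(I ∩ [j]) for all j}`. -/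
def schubertVariety (k : ℕ) {n : ℕ} (I : Finset (Fin n)) : Set (Gr k n) :=
  {V | ∀ j : ℕ, j ≤ n →
    projDim {c : Fin n | (c : ℕ) + 1 ≤ j} V ≤ (I.filter fun c : Fin n => (c : ℕ) + 1 ≤ j).card}

/-! ### Affine permutations and their Bruhat order -/

/-- `f` is an affine permutation: a bijection of `ℤ` with `f(i + n) = f(i) + n`. -/
def IsAffine (n : ℕ) (f : Equiv.Perm ℤ) : Prop := ∀ i : ℤ, f (i + n) = f i + n

/-- The length of an affine permutation: the number of inversions `(i, j)` modulo the simultaneous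
shift by multiples of `n`; every class has exactly one member with `i ∈ [1, n]`. -/
def length (n : ℕ) (f : Equiv.Perm ℤ) : ℕ :=
  {p : ℤ × ℤ | 1 ≤ p.1 ∧ p.1 ≤ n ∧ p.1 < p.2 ∧ f p.2 < f p.1}.ncard

/-- `t` is a reflection of the affine symmetric group: it exchanges `i + rn` and `j + rn` for all
`r ∈ ℤ`, where `i ≢ j` modulo `n`, and fixes all other integers. -/
def IsReflection (n : ℕ) (t : Equiv.Perm ℤ) : Prop :=
  ∃ i j : ℤ, ¬ i ≡ j [ZMOD n] ∧
    (∀ r : ℤ, t (i + r * n) = j + r * n ∧ t (j + r * n) = i + r * n) ∧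
    ∀ m : ℤ, ¬ m ≡ i [ZMOD n] → ¬ m ≡ j [ZMOD n] → t m = m

/-- The (strong) Bruhat order on affine permutations: the reflexive transitive closure of
`f < f t` for reflections `t` with `ℓ(f) < ℓ(f t)`. Two comparable elements have the same
ball number. -/
def BruhatLE (n : ℕ) : Equiv.Perm ℤ → Equiv.Perm ℤ → Prop :=
  Relation.ReflTransGen fun f g => ∃ t, IsReflection n t ∧ g = f * t ∧ length n f < length n g

/-- `Bound(k,n)`: the bounded affine permutations with ball number
`(1/n) ∑_{i=1}^n (f(i) - i) = k`. -/
def Bound (k n : ℕ) : Type :=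
  {f : Equiv.Perm ℤ // IsAffine n f ∧ (∀ i : ℤ, i ≤ f i ∧ f i ≤ i + n) ∧
    ∑ i ∈ Finset.Icc (1 : ℤ) n, (f i - i) = n * k}

/-- The juggling state of `f` at time `t`: the set `{f(i) - t | i ≤ t}`. -/
def jugglingState (f : Equiv.Perm ℤ) (t : ℤ) : Set ℤ := {x | ∃ i ≤ t, x = f i - t}

open Classical in
/-- The juggling states `J_i = st(f, i - 1) ∩ [n]` of the sequence `𝓙(f) = (J_1, …, J_n)`. -/
def jugglingSet {k n : ℕ} (f : Bound k n) (i : ℤ) : Finset (Fin n) :=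
  Finset.univ.filter fun c : Fin n => ((c : ℕ) : ℤ) + 1 ∈ jugglingState f.1 (i - 1)

/-! ### Cyclic rank matrices and positroid varieties -/

/-- `R_j(S) = k - #{x ∈ S | x > j}` for a juggling state `S` with `k` balls. -/
def stateRank (k : ℕ) (S : Set ℤ) (j : ℤ) : ℤ := k - ({x ∈ S | j < x}.ncard : ℤ)

/-- The cyclic rank matrix of `f`: `r_{ij} = R_{j-i+1}(st(f, i - 1))`. -/
def rankMatrix {k n : ℕ} (f : Bound k n) (i j : ℤ) : ℤ :=
  stateRank k (jugglingState f.1 (i - 1)) (j - i + 1)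

/-- The cyclic rank matrix of `V`: `r_{ij}(V) = j - i + 1` for `j < i`, and
`r_{ij}(V) = dim Project_{{i, i+1, …, j}}(V)` for `i ≤ j`, with indices modulo `n`. -/
def cyclicRank {k n : ℕ} (V : Gr k n) (i j : ℤ) : ℤ :=
  if j < i then j - i + 1
  else projDim {c : Fin n | ∃ m : ℤ, i ≤ m ∧ m ≤ j ∧ m ≡ ((c : ℕ) : ℤ) + 1 [ZMOD n]} V

/-- The open positroid variety: all `V` whose cyclic rank matrix is that of `f`. -/
def openPositroidVariety {k n : ℕ} (f : Bound k n) : Set (Gr k n) :=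
  {V | ∀ i j : ℤ, cyclicRank V i j = rankMatrix f i j}

/-- The positroid variety: the (Zariski) closure of the open positroid variety. -/
def positroidVariety {k n : ℕ} (f : Bound k n) : Set (Gr k n) :=
  closure (openPositroidVariety f)

/-- A stratification of a space: a finite partition into nonempty locally closed subsets such that
the closure of every part is a union of parts. -/
structure IsStratification {X ι : Type*} [TopologicalSpace X] (S : ι → Set X) : Prop where
  finite : Finite ι
  nonempty : ∀ a, (S a).Nonempty
  disjoint : ∀ a b, a ≠ b → Disjoint (S a) (S b)
  cover : ⋃ a, S a = Set.univ
  locallyClosed : ∀ a, IsLocallyClosed (S a)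
  closure_eq : ∀ a, ∃ A : Set ι, closure (S a) = ⋃ b ∈ A, S b

end

end Positroid

namespace Positroid

/-! ### Affine permutations -/

/-! Extend the columns of a matrix with row space `V` to an `n`-periodic sequence `v` indexed by ℤ.
Sending `a` to the least `b ≥ a` with `v a` in the span of `v (a + 1), …, v b` defines a bounded
affine permutation `f` (`exists_isFirstReturn`). The rank of `[a, b]` exceeds that of `[a + 1, b]`
by one exactly when `b < f a`, so the cyclic ranks and `f` determine each other, and `r_{ij}(f) = k
- #{c < i | f c > j}`. Hence every `V` lies in exactly one open positroid variety
(`exists_mem_openPositroidVariety`, `eq_of_mem_openPositroidVariety`).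

Combinatorial half: going up in the Bruhat order can only raise the numbers `#{c < a | f c > b}`,
that is, lower the rank matrix. Conversely, if the rank matrix of `g` is bounded by that of `f`,
then `g` is reached from `f` by elementary steps that never leave `Bound(k,n)`
(`Bound.reflTransGen_of_rankMatrix_le`). So the Bruhat order is the entrywise order of rank
matrices, reversed.

Geometric half: for an elementary step from `f` to `g`, a periodic sequence with first return map
`g` is the limit of a one-parameter family with first return map `f`
(`exists_isFirstReturn_tendsto`). Limits of matrices stay in Zariski closures, so the open variety
of `g` lies in the closure of that of `f`. Iterating along chains, every `V` whose cyclic ranks are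
bounded by those of `f` lies in `Π_f`. Upper bounds on ranks are closed conditions, so `Π_f` is
exactly the locus of these bounds (`positroidVariety_eq_setOf_cyclicRank_le`).

The rest follows. The rank criterion turns this locus into the union over `f' ≥ f`. The Schubert
conditions are the same bounds for intervals of length at most `n` starting at `1, …, n`.
Nonemptiness descends along elementary steps from coordinate subspaces. -/

theorem IsAffine.apply_add_mul {n : ℕ} {f : Equiv.Perm ℤ} (hf : IsAffine n f) (i r : ℤ) :
    f (i + r * n) = f i + r * n := by
  induction r using Int.induction_on with
  | zero => simp
  | succ m ih =>
    have h := hf (i + m * n)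
    rw [ih] at h
    have e : i + ((m : ℤ) + 1) * n = i + m * n + n := by ring
    rw [e, h]; ring
  | pred m ih =>
    have h := hf (i + (-(m : ℤ) - 1) * n)
    have e : i + (-(m : ℤ) - 1) * n + n = i + -(m : ℤ) * n := by ring
    rw [e, ih] at h
    linarith

theorem exists_eq_add_mul_of_modEq {n m i : ℤ} (h : m ≡ i [ZMOD n]) : ∃ r : ℤ, m = i + r * n := by
  obtain ⟨r, hr⟩ := Int.modEq_iff_dvd.1 h
  exact ⟨-r, by linarith⟩

/-- Every integer is congruent to one of `1, …, n`. -/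
theorem exists_mem_Icc_add_mul {n : ℕ} (hn : 0 < n) (m : ℤ) :
    ∃ i r : ℤ, 1 ≤ i ∧ i ≤ n ∧ m = i + r * n := by
  have hn' : (0 : ℤ) < n := by exact_mod_cast hn
  refine ⟨(m - 1) % n + 1, (m - 1) / n, ?_, ?_, ?_⟩
  · have := Int.emod_nonneg (m - 1) hn'.ne'
    omega
  · have := Int.emod_lt_of_pos (m - 1) hn'
    omega
  · have := Int.emod_add_mul_ediv (m - 1) n
    linarith

theorem IsAffine.exists_displacement_le {n : ℕ} (hn : 0 < n) {f : Equiv.Perm ℤ}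
    (hf : IsAffine n f) : ∃ M : ℤ, 0 ≤ M ∧ ∀ i, |f i - i| ≤ M := by
  refine ⟨∑ i ∈ Finset.Icc (1 : ℤ) n, |f i - i|, Finset.sum_nonneg fun _ _ => abs_nonneg _, ?_⟩
  intro m
  obtain ⟨i, r, h1, h2, rfl⟩ := exists_mem_Icc_add_mul hn m
  rw [hf.apply_add_mul, add_sub_add_right_eq_sub]
  exact Finset.single_le_sum (f := fun i => |f i - i|) (fun _ _ => abs_nonneg _)
    (Finset.mem_Icc.2 ⟨h1, h2⟩)

/-- `t` exchanges the residue classes of `i < j`, moving the first one up and the second one down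
by `j - i`. -/
structure IsSwap (n : ℕ) (i j : ℤ) (t : Equiv.Perm ℤ) : Prop where
  lt : i < j
  not_modEq : ¬ i ≡ j [ZMOD n]
  apply_left : ∀ m, m ≡ i [ZMOD n] → t m = m + (j - i)
  apply_right : ∀ m, m ≡ j [ZMOD n] → t m = m - (j - i)
  apply_of_not : ∀ m, ¬ m ≡ i [ZMOD n] → ¬ m ≡ j [ZMOD n] → t m = m

theorem IsReflection.exists_isSwap {n : ℕ} {t : Equiv.Perm ℤ} (ht : IsReflection n t) :
    ∃ i j, IsSwap n i j t := by
  have key : ∀ i j : ℤ, i < j → ¬ i ≡ j [ZMOD n] →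
      (∀ r : ℤ, t (i + r * n) = j + r * n ∧ t (j + r * n) = i + r * n) →
      (∀ m : ℤ, ¬ m ≡ i [ZMOD n] → ¬ m ≡ j [ZMOD n] → t m = m) → IsSwap n i j t := by
    intro i j hij h1 h2 h3
    refine ⟨hij, h1, ?_, ?_, h3⟩
    · intro m hm
      obtain ⟨r, rfl⟩ := exists_eq_add_mul_of_modEq hm
      rw [(h2 r).1]; ring
    · intro m hm
      obtain ⟨r, rfl⟩ := exists_eq_add_mul_of_modEq hm
      rw [(h2 r).2]; ring
  obtain ⟨i, j, h1, h2, h3⟩ := ht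
  rcases lt_trichotomy i j with h | h | h
  · exact ⟨i, j, key i j h h1 h2 h3⟩
  · exact absurd (h ▸ Int.ModEq.refl _) h1
  · exact ⟨j, i, key j i h (fun h' => h1 h'.symm) (fun r => (h2 r).symm) fun m hm hm' => h3 m hm' hm⟩

namespace IsSwap

variable {n : ℕ} {i j : ℤ} {t : Equiv.Perm ℤ}

theorem isReflection (ht : IsSwap n i j t) : IsReflection n t := by
  refine ⟨i, j, ht.not_modEq, fun r => ⟨?_, ?_⟩, ht.apply_of_not⟩
  · rw [ht.apply_left _ (by simp [Int.ModEq])]; ring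
  · rw [ht.apply_right _ (by simp [Int.ModEq])]; ring

theorem apply_apply (ht : IsSwap n i j t) (m : ℤ) : t (t m) = m := by
  by_cases h1 : m ≡ i [ZMOD n]
  · rw [ht.apply_left m h1, ht.apply_right]
    · ring
    · simpa using h1.add_right (j - i)
  by_cases h2 : m ≡ j [ZMOD n]
  · rw [ht.apply_right m h2, ht.apply_left]
    · ring
    · simpa using h2.sub_right (j - i)
  rw [ht.apply_of_not m h1 h2, ht.apply_of_not m h1 h2]

theorem isAffine (ht : IsSwap n i j t) : IsAffine n t := by
  intro m
  have e : m + n ≡ m [ZMOD n] := by simp [Int.ModEq]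
  by_cases h1 : m ≡ i [ZMOD n]
  · rw [ht.apply_left m h1, ht.apply_left _ (e.trans h1)]; ring
  by_cases h2 : m ≡ j [ZMOD n]
  · rw [ht.apply_right m h2, ht.apply_right _ (e.trans h2)]; ring
  rw [ht.apply_of_not m h1 h2, ht.apply_of_not _ (fun h => h1 (e.symm.trans h))
    (fun h => h2 (e.symm.trans h))]

theorem left (ht : IsSwap n i j t) : t i = j := by
  rw [ht.apply_left i rfl]; ring

theorem right (ht : IsSwap n i j t) : t j = i := by
  rw [ht.apply_right j rfl]; ring

/-- If `f i < f j`, then `t` moves arguments and values of `f` in the same direction. -/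
theorem moves (ht : IsSwap n i j t) {f : Equiv.Perm ℤ} (hf : IsAffine n f) (hij : f i < f j)
    (m : ℤ) : (t m = m + (j - i) ∧ f m < f (t m)) ∨ (t m = m - (j - i) ∧ f (t m) < f m) ∨
      (t m = m ∧ f (t m) = f m) := by
  by_cases h1 : m ≡ i [ZMOD n]
  · refine Or.inl ⟨ht.apply_left m h1, ?_⟩
    rw [ht.apply_left m h1]
    obtain ⟨r, rfl⟩ := exists_eq_add_mul_of_modEq h1
    have e : i + r * n + (j - i) = j + r * n := by ring
    rw [e, hf.apply_add_mul, hf.apply_add_mul]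
    linarith
  by_cases h2 : m ≡ j [ZMOD n]
  · refine Or.inr (Or.inl ⟨ht.apply_right m h2, ?_⟩)
    rw [ht.apply_right m h2]
    obtain ⟨r, rfl⟩ := exists_eq_add_mul_of_modEq h2
    have e : j + r * n - (j - i) = i + r * n := by ring
    rw [e, hf.apply_add_mul, hf.apply_add_mul]
    linarith
  · have := ht.apply_of_not m h1 h2
    exact Or.inr (Or.inr ⟨this, by rw [this]⟩)

end IsSwap

theorem IsAffine.mul {n : ℕ} {f t : Equiv.Perm ℤ} (hf : IsAffine n f) (ht : IsAffine n t) :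
    IsAffine n (f * t) := by
  intro i
  simp only [Equiv.Perm.mul_apply]
  rw [ht i, hf (t i)]

/-- The swap of the residue classes of `i` and `j`. -/
theorem exists_isSwap {n : ℕ} {i j : ℤ} (hij : i < j) (h : ¬ i ≡ j [ZMOD n]) :
    ∃ t, IsSwap n i j t := by
  classical
  let s : ℤ → ℤ := fun m => if m ≡ i [ZMOD n] then m + (j - i) else
    if m ≡ j [ZMOD n] then m - (j - i) else m
  have hs1 : ∀ m, m ≡ i [ZMOD n] → s m = m + (j - i) := fun m hm => by simp [s, hm]
  have hs2 : ∀ m, m ≡ j [ZMOD n] → s m = m - (j - i) := fun m hm => by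
    have : ¬ m ≡ i [ZMOD n] := fun h' => h (h'.symm.trans hm)
    simp [s, hm, this]
  have hs3 : ∀ m, ¬ m ≡ i [ZMOD n] → ¬ m ≡ j [ZMOD n] → s m = m := fun m h1 h2 => by
    simp [s, h1, h2]
  have inv : Function.Involutive s := by
    intro m
    by_cases h1 : m ≡ i [ZMOD n]
    · rw [hs1 m h1, hs2 _ (by simpa using h1.add_right (j - i))]; ring
    by_cases h2 : m ≡ j [ZMOD n]
    · rw [hs2 m h2, hs1 _ (by simpa using h2.sub_right (j - i))]; ring
    rw [hs3 m h1 h2, hs3 m h1 h2]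
  exact ⟨inv.toPerm, hij, h, hs1, hs2, hs3⟩

/-! ### Length -/

theorem IsAffine.finite_inversions {n : ℕ} (hn : 0 < n) {f : Equiv.Perm ℤ} (hf : IsAffine n f) :
    {p : ℤ × ℤ | 1 ≤ p.1 ∧ p.1 ≤ n ∧ p.1 < p.2 ∧ f p.2 < f p.1}.Finite := by
  obtain ⟨M, -, hM⟩ := hf.exists_displacement_le hn
  refine ((Set.finite_Icc (1 : ℤ) n).prod (Set.finite_Icc (1 : ℤ) (n + 2 * M))).subset ?_
  rintro ⟨a, b⟩ ⟨h1, h2, h3, h4⟩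
  have ha := abs_le.1 (hM a)
  have hb := abs_le.1 (hM b)
  simp only [Set.mem_prod, Set.mem_Icc] at *
  omega

/-- The map `ψ` sends an inversion of `f` to its image under `t` when that is still increasing, and
fixes it otherwise; it is injective into the inversions of `f * t` and commutes with translation by
`n`. The class of `(i, j)` is an inversion of `f * t` that it misses, whence strictness. -/
theorem IsSwap.length_lt {n : ℕ} (hn : 0 < n) {i j : ℤ} {t f : Equiv.Perm ℤ}
    (ht : IsSwap n i j t) (hf : IsAffine n f) (hij : f i < f j) :
    length n f < length n (f * t) := by
  have hn' : (0 : ℤ) < n := by exact_mod_cast hn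
  have hlt := ht.lt
  have hft := hf.mul ht.isAffine
  let ψ : ℤ × ℤ → ℤ × ℤ := fun p => if t p.1 < t p.2 then (t p.1, t p.2) else p
  -- The translate of `ψ p` whose first entry lies in `[1, n]`, as `length` requires.
  let φ : ℤ × ℤ → ℤ × ℤ := fun p =>
    ((ψ p).1 - ((ψ p).1 - 1) / n * n, (ψ p).2 - ((ψ p).1 - 1) / n * n)
  have hψ_inv : ∀ p : ℤ × ℤ, p.1 < p.2 → f p.2 < f p.1 →
      (ψ p).1 < (ψ p).2 ∧ f (t (ψ p).2) < f (t (ψ p).1) := by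
    rintro ⟨a, b⟩ h1 h2
    by_cases h : t a < t b
    · simp only [ψ, h, if_true, ht.apply_apply, true_and]; exact h2
    · simp only [ψ, h, if_false]
      -- As `t` reverses `a < b`, it does not lower `a` and does not raise `b`; by `moves` the
      -- values follow, so the inversion survives.
      refine ⟨h1, ?_⟩
      simp only at h1 h2
      have := ht.moves hf hij a
      have := ht.moves hf hij b
      have hne : t a ≠ t b := fun e => h1.ne (t.injective e)
      omega
  have hψ_ne : ∀ p : ℤ × ℤ, p.1 < p.2 → f p.2 < f p.1 → ∀ r : ℤ,
      ψ p ≠ (i + r * n, j + r * n) := by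
    rintro ⟨a, b⟩ h1 h2 r he
    have hti : t (i + r * n) = j + r * n := by rw [ht.isAffine.apply_add_mul, ht.left]
    have htj : t (j + r * n) = i + r * n := by rw [ht.isAffine.apply_add_mul, ht.right]
    by_cases h : t a < t b
    · simp only [ψ, h, if_true, Prod.mk.injEq] at he
      have ha : a = j + r * n := by rw [← ht.apply_apply a, he.1, hti]
      have hb : b = i + r * n := by rw [← ht.apply_apply b, he.2, htj]
      simp only at h1
      omega
    · simp only [ψ, h, if_false, Prod.mk.injEq] at he
      simp only [he.1, he.2, hf.apply_add_mul] at h2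
      omega
  have hψ_inj : ∀ p q : ℤ × ℤ, p.1 < p.2 → q.1 < q.2 → ψ p = ψ q → p = q := by
    rintro ⟨a, b⟩ ⟨c, d⟩ h1 h2 he
    simp only at h1 h2
    by_cases h : t a < t b <;> by_cases h' : t c < t d <;>
      simp only [ψ, h, h', if_true, if_false, Prod.mk.injEq] at he ⊢
    · exact ⟨t.injective he.1, t.injective he.2⟩
    · rw [← he.1, ← he.2, ht.apply_apply, ht.apply_apply] at h'
      exact absurd h1 h'
    · rw [he.1, he.2, ht.apply_apply, ht.apply_apply] at h
      exact absurd h2 h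
    · exact he
  have hψ_add : ∀ (p : ℤ × ℤ) (r : ℤ), ψ (p.1 + r * n, p.2 + r * n) =
      ((ψ p).1 + r * n, (ψ p).2 + r * n) := by
    rintro ⟨a, b⟩ r
    by_cases h : t a < t b <;> simp [ψ, ht.isAffine.apply_add_mul, h]
  unfold length
  rw [← Set.InjOn.ncard_image (f := φ) (s := {p : ℤ × ℤ | _})]
  · apply Set.ncard_lt_ncard _ (hft.finite_inversions hn)
    rw [Set.ssubset_iff_exists]
    constructor
    · rintro _ ⟨p, ⟨-, -, h3, h4⟩, rfl⟩
      obtain ⟨h5, h6⟩ := hψ_inv p h3 h4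
      have e1 := Int.emod_add_mul_ediv ((ψ p).1 - 1) n
      have e2 := Int.emod_nonneg ((ψ p).1 - 1) hn'.ne'
      have e3 := Int.emod_lt_of_pos ((ψ p).1 - 1) hn'
      have e4 : ((ψ p).1 - 1) / n * n = n * (((ψ p).1 - 1) / n) := mul_comm _ _
      refine ⟨?_, ?_, ?_, ?_⟩
      · simp only [φ]; omega
      · simp only [φ]; omega
      · simp only [φ]; omega
      · have := hft.apply_add_mul (ψ p).1 (-(((ψ p).1 - 1) / n))
        have := hft.apply_add_mul (ψ p).2 (-(((ψ p).1 - 1) / n))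
        simp only [φ, sub_eq_add_neg, ← neg_mul, Equiv.Perm.mul_apply] at *
        linarith
    · have e1 := Int.emod_add_mul_ediv (i - 1) n
      have e2 := Int.emod_nonneg (i - 1) hn'.ne'
      have e3 := Int.emod_lt_of_pos (i - 1) hn'
      have e4 : (i - 1) / n * n = n * ((i - 1) / n) := mul_comm _ _
      refine ⟨(i + -((i - 1) / n) * n, j + -((i - 1) / n) * n), ⟨?_, ?_, ?_, ?_⟩, ?_⟩
      · simp only [neg_mul]; omega
      · simp only [neg_mul]; omega
      · simp only; omega
      · simp only [hft.apply_add_mul, Equiv.Perm.mul_apply, ht.left, ht.right]; omega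
      · rintro ⟨p, ⟨-, -, h3, h4⟩, he⟩
        simp only [φ, Prod.mk.injEq] at he
        refine hψ_ne p h3 h4 (-((i - 1) / n) + ((ψ p).1 - 1) / n) (Prod.ext ?_ ?_)
        · simp only [add_mul]; linarith [he.1]
        · simp only [add_mul]; linarith [he.2]
  · rintro p ⟨h1, h2, h3, h4⟩ q ⟨h5, h6, h7, h8⟩ he
    simp only [φ, Prod.mk.injEq] at he
    set r := ((ψ p).1 - 1) / n - ((ψ q).1 - 1) / n with hr
    have h9 : ψ p = ψ (q.1 + r * n, q.2 + r * n) := by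
      rw [hψ_add]
      refine Prod.ext ?_ ?_
      · simp only [hr, sub_mul]; linarith [he.1]
      · simp only [hr, sub_mul]; linarith [he.2]
    have h10 := hψ_inj _ _ h3 (by simpa using h7) h9
    have hr0 : r = 0 := by
      have : p.1 = q.1 + r * n := congrArg Prod.fst h10
      by_contra hne
      rcases lt_or_gt_of_ne hne with h | h
      · have : r * n ≤ -1 * n := mul_le_mul_of_nonneg_right (by omega) hn'.le
        omega
      · have : 1 * n ≤ r * n := mul_le_mul_of_nonneg_right (by omega) hn'.le
        omega
    rw [h10, hr0]; simp

/-! ### Counting crossings -/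

/-- The set counted by the entry at `(a, b)` of a cyclic rank matrix. -/
def crossings (f : Equiv.Perm ℤ) (a b : ℤ) : Set ℤ := {c | c < a ∧ b < f c}

theorem IsAffine.finite_crossings {n : ℕ} (hn : 0 < n) {f : Equiv.Perm ℤ} (hf : IsAffine n f)
    (a b : ℤ) : (crossings f a b).Finite := by
  obtain ⟨M, -, hM⟩ := hf.exists_displacement_le hn
  refine (Set.finite_Icc (b - M) a).subset ?_
  rintro c ⟨h1, h2⟩
  have := abs_le.1 (hM c)
  simp only [Set.mem_Icc]
  omega

/-- A crossing `c` is sent to `t c` if that is still left of `a`. Otherwise `t` moves `c` up, hence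
also raises its value, so `c` remains a crossing of `f * t`. -/
theorem IsSwap.ncard_crossings_le {n : ℕ} (hn : 0 < n) {i j : ℤ} {t f : Equiv.Perm ℤ}
    (ht : IsSwap n i j t) (hf : IsAffine n f) (hij : f i < f j) (a b : ℤ) :
    (crossings f a b).ncard ≤ (crossings (f * t) a b).ncard := by
  have hlt := ht.lt
  apply Set.ncard_le_ncard_of_injOn (fun c => if t c < a then t c else c) _ _
    ((hf.mul ht.isAffine).finite_crossings hn a b)
  · rintro c ⟨h1, h2⟩
    by_cases h : t c < a
    · simp only [h, if_true]
      exact ⟨h, by simpa [ht.apply_apply] using h2⟩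
    · simp only [h, if_false]
      refine ⟨h1, ?_⟩
      simp only [Equiv.Perm.mul_apply]
      have := ht.moves hf hij c
      omega
  · rintro c ⟨h1, h2⟩ d ⟨h3, h4⟩ he
    by_cases h : t c < a <;> by_cases h' : t d < a <;> simp only [h, h', if_true, if_false] at he
    · exact t.injective he
    · rw [← he, ht.apply_apply] at h'
      exact absurd h1 h'
    · rw [he, ht.apply_apply] at h
      exact absurd h3 h
    · exact he

theorem BruhatLE.isAffine_and_ncard_crossings_le {n : ℕ} (hn : 0 < n) {f g : Equiv.Perm ℤ}
    (hf : IsAffine n f) (h : BruhatLE n f g) :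
    IsAffine n g ∧ ∀ a b, (crossings f a b).ncard ≤ (crossings g a b).ncard := by
  induction h with
  | refl => exact ⟨hf, fun _ _ => le_rfl⟩
  | tail _ hstep ih =>
    rename_i g₁ g₂ _
    obtain ⟨hg, hle⟩ := ih
    obtain ⟨t, ht, rfl, hlen⟩ := hstep
    obtain ⟨i, j, hs⟩ := ht.exists_isSwap
    refine ⟨hg.mul hs.isAffine, fun a b => (hle a b).trans ?_⟩
    refine hs.ncard_crossings_le hn hg ?_ a b
    by_contra hcon
    have hne : g₁ i ≠ g₁ j := fun e => hs.lt.ne (g₁.injective e)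
    -- Were `g₁ i > g₁ j`, multiplying `g₁ * t` by `t` again would lengthen it, contradicting
    -- `hlen`.
    have h1 := hs.length_lt hn (hg.mul hs.isAffine)
      (by simp only [Equiv.Perm.mul_apply, hs.left, hs.right]; omega)
    have h2 : g₁ * t * t = g₁ := by
      ext m; simp [hs.apply_apply]
    rw [h2] at h1
    omega

theorem ncard_crossings_succ {f : Equiv.Perm ℤ} {a b : ℤ} (hfin : (crossings f a b).Finite) :
    (crossings f (a + 1) b).ncard = (crossings f a b).ncard + if b < f a then 1 else 0 := by
  by_cases h : b < f a
  · have : crossings f (a + 1) b = insert a (crossings f a b) := by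
      ext c
      simp only [crossings, Set.mem_insert_iff, Set.mem_ofPred_eq]
      constructor
      · rintro ⟨h1, h2⟩
        by_cases hc : c = a
        · exact Or.inl hc
        · exact Or.inr ⟨by omega, h2⟩
      · rintro (rfl | ⟨h1, h2⟩)
        · exact ⟨by omega, h⟩
        · exact ⟨by omega, h2⟩
    rw [this, Set.ncard_insert_of_notMem (fun h' => absurd h'.1 (lt_irrefl a)) hfin, if_pos h]
  · have : crossings f (a + 1) b = crossings f a b := by
      ext c
      simp only [crossings, Set.mem_ofPred_eq]
      constructor
      · rintro ⟨h1, h2⟩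
        refine ⟨?_, h2⟩
        by_contra hc
        have : c = a := by omega
        exact h (this ▸ h2)
      · rintro ⟨h1, h2⟩
        exact ⟨by omega, h2⟩
    rw [this, if_neg h, add_zero]

theorem ncard_crossings_pred {f : Equiv.Perm ℤ} {a b : ℤ} (hfin : (crossings f a b).Finite) :
    (crossings f a (b - 1)).ncard =
      (crossings f a b).ncard + if f.symm b < a then 1 else 0 := by
  by_cases h : f.symm b < a
  · have : crossings f a (b - 1) = insert (f.symm b) (crossings f a b) := by
      ext c
      simp only [crossings, Set.mem_insert_iff, Set.mem_ofPred_eq, Equiv.eq_symm_apply]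
      constructor
      · rintro ⟨h1, h2⟩
        by_cases hc : f c = b
        · exact Or.inl hc
        · exact Or.inr ⟨h1, by omega⟩
      · rintro (hc | ⟨h1, h2⟩)
        · rw [← hc, Equiv.symm_apply_apply] at h
          exact ⟨h, by omega⟩
        · exact ⟨h1, by omega⟩
    rw [this, Set.ncard_insert_of_notMem _ hfin, if_pos h]
    rintro ⟨-, h'⟩
    simp at h'
  · have : crossings f a (b - 1) = crossings f a b := by
      ext c
      simp only [crossings, Set.mem_ofPred_eq]
      constructor
      · rintro ⟨h1, h2⟩
        refine ⟨h1, ?_⟩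
        by_contra hc
        have : c = f.symm b := by rw [Equiv.eq_symm_apply]; omega
        exact h (this ▸ h1)
      · rintro ⟨h1, h2⟩
        exact ⟨h1, by omega⟩
    rw [this, if_neg h, add_zero]

theorem IsAffine.ncard_crossings_add {n : ℕ} {f : Equiv.Perm ℤ} (hf : IsAffine n f) (a b r : ℤ) :
    (crossings f (a + r * n) (b + r * n)).ncard = (crossings f a b).ncard := by
  have : crossings f (a + r * n) (b + r * n) = (fun c => c + r * n) '' crossings f a b := by
    ext c
    simp only [crossings, Set.mem_ofPred_eq, Set.mem_image]
    constructor
    · rintro ⟨h1, h2⟩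
      refine ⟨c + -r * n, ⟨by linarith, ?_⟩, by ring⟩
      rw [hf.apply_add_mul]
      linarith
    · rintro ⟨d, ⟨h1, h2⟩, rfl⟩
      rw [hf.apply_add_mul]
      exact ⟨by linarith, by linarith⟩
  rw [this, Set.ncard_image_of_injective _ (add_left_injective _)]

theorem ncard_crossings_eq_zero {n : ℕ} {f : Equiv.Perm ℤ} (hb : ∀ i, f i ≤ i + n) {a b : ℤ}
    (h : a + n ≤ b + 1) : (crossings f a b).ncard = 0 := by
  have : crossings f a b = ∅ := by
    ext c
    simp only [crossings, Set.mem_ofPred_eq, Set.mem_empty_iff_false, iff_false, not_and, not_lt]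
    intro hc
    have := hb c
    omega
  rw [this, Set.ncard_empty]

theorem sum_Icc_shift_of_periodic {M : Type*} [AddCommGroup M] (F : ℤ → M) (n : ℕ)
    (hF : F (n + 1) = F 1) :
    ∑ i ∈ Finset.Icc (1 : ℤ) n, F (i + 1) = ∑ i ∈ Finset.Icc (1 : ℤ) n, F i := by
  have key : ∀ m : ℕ, ∑ i ∈ Finset.Icc (1 : ℤ) m, F (i + 1) + F 1 =
      ∑ i ∈ Finset.Icc (1 : ℤ) m, F i + F (m + 1) := by
    intro m
    induction m with
    | zero => simp
    | succ m ih =>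
      have : Finset.Icc (1 : ℤ) ((m + 1 : ℕ) : ℤ) = insert ((m : ℤ) + 1) (Finset.Icc (1 : ℤ) m) := by
        ext x
        simp only [Finset.mem_Icc, Finset.mem_insert]
        push_cast
        omega
      rw [this, Finset.sum_insert (by simp), Finset.sum_insert (by simp), add_assoc, ih]
      push_cast
      abel
  have := key n
  rw [hF] at this
  exact add_right_cancel this

/-- The displacement `f i - i` counts the `d ∈ [0, n)` with `i + d < f i`. For fixed `d` these
indicators are increments of the crossing numbers, and by periodicity their sum over a period is `T
d - T (d + 1)`; the sum over `d` telescopes, and `T n = 0`. -/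
theorem sum_displacement_eq {n : ℕ} (hn : 0 < n) {f : Equiv.Perm ℤ} (hf : IsAffine n f)
    (hb : ∀ i, i ≤ f i ∧ f i ≤ i + n) :
    ∑ i ∈ Finset.Icc (1 : ℤ) n, (f i - i) =
      ∑ i ∈ Finset.Icc (1 : ℤ) n, ((crossings f i (i - 1)).ncard : ℤ) := by
  let T : ℕ → ℤ := fun d => ∑ i ∈ Finset.Icc (1 : ℤ) n, ((crossings f i (i + d - 1)).ncard : ℤ)
  have h1 : ∀ i, f i - i = ∑ d ∈ Finset.range n, if i + (d : ℤ) < f i then (1 : ℤ) else 0 := by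
    intro i
    obtain ⟨h1, h2⟩ := hb i
    rw [Finset.sum_ite, Finset.sum_const_zero, add_zero, Finset.sum_const, nsmul_one]
    have : (Finset.range n).filter (fun d : ℕ => i + (d : ℤ) < f i) =
        Finset.range (f i - i).toNat := by
      ext d
      simp only [Finset.mem_filter, Finset.mem_range]
      omega
    rw [this, Finset.card_range]
    omega
  have h2 : ∀ d : ℕ, ∑ i ∈ Finset.Icc (1 : ℤ) n, (if i + (d : ℤ) < f i then (1 : ℤ) else 0) =
      T d - T (d + 1) := by
    intro d
    have e : T d = ∑ i ∈ Finset.Icc (1 : ℤ) n, ((crossings f (i + 1) (i + d)).ncard : ℤ) := by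
      have := sum_Icc_shift_of_periodic
        (fun i : ℤ => ((crossings f i (i + d - 1)).ncard : ℤ)) n (by
          have := hf.ncard_crossings_add 1 d 1
          rw [one_mul] at this
          have e1 : (n : ℤ) + 1 = 1 + n := add_comm _ _
          have e2 : (n : ℤ) + 1 + d - 1 = d + n := by ring
          have e3 : (1 : ℤ) + d - 1 = d := by ring
          simp only [e2, e3]
          rw [e1, this])
      change ∑ i ∈ Finset.Icc (1 : ℤ) n, ((crossings f i (i + d - 1)).ncard : ℤ) = _
      rw [← this]
      refine Finset.sum_congr rfl fun i _ => ?_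
      have e : i + 1 + (d : ℤ) - 1 = i + d := by ring
      rw [e]
    rw [e, ← Finset.sum_sub_distrib]
    refine Finset.sum_congr rfl fun i _ => ?_
    have e : i + ((d + 1 : ℕ) : ℤ) - 1 = i + d := by push_cast; ring
    rw [e, ncard_crossings_succ (hf.finite_crossings hn _ _)]
    push_cast
    ring
  rw [Finset.sum_congr rfl fun i _ => h1 i, Finset.sum_comm, Finset.sum_congr rfl fun d _ => h2 d,
    Finset.sum_range_sub']
  have : T n = 0 := Finset.sum_eq_zero fun i _ => by
    rw [ncard_crossings_eq_zero (fun i => (hb i).2) (by omega)]; rfl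
  rw [this, sub_zero]
  simp [T]

/-- A function with the same increments and boundary values as a cyclic rank matrix is equal
to it. -/
theorem eq_sub_ncard_crossings {n : ℕ} (hn : 0 < n) {f : Equiv.Perm ℤ} (hf : IsAffine n f)
    (hb : ∀ i, f i ≤ i + n) {k : ℤ} (ρ : ℤ → ℤ → ℤ)
    (h1 : ∀ a b, ρ a b = ρ (a + 1) b + if b < f a then 1 else 0)
    (h2 : ∀ a b : ℤ, a + n ≤ b + 1 → ρ a b = k) (a b : ℤ) :
    ρ a b = k - ((crossings f a b).ncard : ℤ) := by
  have key : ∀ m : ℕ, ρ (b + 1 - n + m) b = k - ((crossings f (b + 1 - n + m) b).ncard : ℤ) := by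
    intro m
    induction m with
    | zero => rw [h2 _ _ (by simp), ncard_crossings_eq_zero hb (by simp)]; simp
    | succ m ih =>
      rw [h1] at ih
      push_cast
      rw [← add_assoc, ncard_crossings_succ (hf.finite_crossings hn _ _)]
      push_cast
      linarith
  rcases le_or_gt (a + n) (b + 1) with h | h
  · rw [h2 _ _ h, ncard_crossings_eq_zero hb h]; simp
  · have := key (a - (b + 1 - n)).toNat
    have e : b + 1 - n + ((a - (b + 1 - n)).toNat : ℤ) = a := by omega
    rwa [e] at this

/-! ### Rank matrices of bounded affine permutations. -/

namespace Bound

variable {k n : ℕ}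

theorem isAffine (f : Bound k n) : IsAffine n f.1 := f.2.1

theorem le_apply (f : Bound k n) (i : ℤ) : i ≤ f.1 i := (f.2.2.1 i).1

theorem apply_le (f : Bound k n) (i : ℤ) : f.1 i ≤ i + n := (f.2.2.1 i).2

/-- The count is independent of `a`, since passing from `a` to `a + 1` one ball is thrown exactly
when one lands. Its average over a period is the ball number, by `sum_displacement_eq`. -/
theorem ncard_crossings_diag (hn : 0 < n) (f : Bound k n) (a : ℤ) :
    (crossings f.1 a (a - 1)).ncard = k := by
  have hstep : ∀ a, (crossings f.1 (a + 1) a).ncard = (crossings f.1 a (a - 1)).ncard := by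
    intro a
    have hfin := f.isAffine.finite_crossings hn a a
    rw [ncard_crossings_succ hfin, ncard_crossings_pred hfin]
    congr 1
    -- Both conditions say `f a ≠ a`, because `f` never moves an integer down.
    refine if_congr ?_ rfl rfl
    have h1 := f.le_apply a
    have h2 := f.le_apply (f.1.symm a)
    rw [Equiv.apply_symm_apply] at h2
    rw [lt_iff_le_and_ne, lt_iff_le_and_ne, and_iff_right h1, and_iff_right h2, ne_eq, ne_eq,
      Equiv.symm_apply_eq, eq_comm]
  have hconst : ∀ a, (crossings f.1 a (a - 1)).ncard = (crossings f.1 0 (0 - 1)).ncard := by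
    intro a
    induction a using Int.induction_on with
    | zero => rfl
    | succ m ih => rw [← ih, ← hstep m]; simp
    | pred m ih =>
      rw [← ih, ← hstep (-(m : ℤ) - 1)]; simp
  have hsum := sum_displacement_eq hn f.isAffine f.2.2.1
  rw [f.2.2.2, Finset.sum_congr rfl fun i _ => congrArg Nat.cast (hconst i), Finset.sum_const,
    Int.card_Icc, nsmul_eq_mul] at hsum
  have hn' : (n : ℤ) ≠ 0 := by exact_mod_cast hn.ne'
  have e : (((n : ℤ) + 1 - 1).toNat : ℤ) = n := by simp
  rw [e] at hsum
  have := mul_left_cancel₀ hn' hsum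
  rw [hconst a]
  exact_mod_cast this.symm

theorem ncard_crossings_of_lt (hn : 0 < n) (f : Bound k n) {a b : ℤ} (h : b < a) :
    ((crossings f.1 a b).ncard : ℤ) = k - (b - a + 1) := by
  have key : ∀ m : ℕ, ((crossings f.1 (b + 1 + m) b).ncard : ℤ) = k + m := by
    intro m
    induction m with
    | zero =>
      have := f.ncard_crossings_diag hn (b + 1)
      simp only [add_sub_cancel_right] at this
      simp [this]
    | succ m ih =>
      have e : b + 1 + ((m + 1 : ℕ) : ℤ) = b + 1 + m + 1 := by push_cast; ring
      have h1 := f.le_apply (b + 1 + m)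
      rw [e, ncard_crossings_succ (f.isAffine.finite_crossings hn _ _), if_pos (by omega)]
      push_cast
      rw [ih]
      ring
  have := key (a - b - 1).toNat
  have e : b + 1 + ((a - b - 1).toNat : ℤ) = a := by omega
  rw [e] at this
  rw [this]
  omega

theorem rankMatrix_eq (f : Bound k n) (a b : ℤ) :
    rankMatrix f a b = k - ((crossings f.1 a b).ncard : ℤ) := by
  unfold rankMatrix stateRank
  congr 2
  have : {x ∈ jugglingState f.1 (a - 1) | b - a + 1 < x} =
      (fun c => f.1 c - (a - 1)) '' crossings f.1 a b := by
    ext x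
    simp only [jugglingState, crossings, Set.mem_ofPred_eq, Set.mem_image]
    constructor
    · rintro ⟨⟨c, h1, rfl⟩, h2⟩
      exact ⟨c, ⟨by omega, by omega⟩, rfl⟩
    · rintro ⟨c, ⟨h1, h2⟩, rfl⟩
      exact ⟨⟨c, by omega, rfl⟩, by omega⟩
  rw [this, Set.ncard_image_of_injective]
  intro c d h
  simpa using h

theorem rankMatrix_sub (hn : 0 < n) (f : Bound k n) (a b : ℤ) :
    rankMatrix f a b = rankMatrix f (a + 1) b + if b < f.1 a then 1 else 0 := by
  rw [rankMatrix_eq, rankMatrix_eq, ncard_crossings_succ (f.isAffine.finite_crossings hn _ _)]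
  push_cast
  ring

theorem rankMatrix_of_le (f : Bound k n) {a b : ℤ} (h : a + n ≤ b + 1) : rankMatrix f a b = k := by
  rw [rankMatrix_eq, ncard_crossings_eq_zero f.apply_le h]
  simp

theorem rankMatrix_of_lt (hn : 0 < n) (f : Bound k n) {a b : ℤ} (h : b < a) :
    rankMatrix f a b = b - a + 1 := by
  rw [rankMatrix_eq, f.ncard_crossings_of_lt hn h]
  ring

theorem rankMatrix_add (f : Bound k n) (a b r : ℤ) :
    rankMatrix f (a + r * n) (b + r * n) = rankMatrix f a b := by
  rw [rankMatrix_eq, rankMatrix_eq, f.isAffine.ncard_crossings_add]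

theorem rankMatrix_unique (hn : 0 < n) (f : Bound k n) (ρ : ℤ → ℤ → ℤ)
    (h1 : ∀ a b, ρ a b = ρ (a + 1) b + if b < f.1 a then 1 else 0)
    (h2 : ∀ a b : ℤ, a + n ≤ b + 1 → ρ a b = k) (a b : ℤ) : ρ a b = rankMatrix f a b := by
  rw [rankMatrix_eq]
  exact eq_sub_ncard_crossings hn f.isAffine f.apply_le ρ h1 h2 a b

/-- The increments of the rank matrix decide `b < f a` for all `a` and `b`. -/
theorem ext_of_rankMatrix (hn : 0 < n) {f g : Bound k n}
    (h : ∀ a b, rankMatrix f a b = rankMatrix g a b) : f = g := by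
  have key : ∀ a b, b < f.1 a ↔ b < g.1 a := by
    intro a b
    have h1 := f.rankMatrix_sub hn a b
    have h2 := g.rankMatrix_sub hn a b
    rw [h, h, h2] at h1
    have := add_left_cancel h1
    by_cases ha : b < f.1 a <;> by_cases hb : b < g.1 a <;>
      simp only [ha, hb, if_true, if_false, one_ne_zero, zero_ne_one] at this ⊢
  refine Subtype.ext (Equiv.ext fun a => ?_)
  have h1 := key a (f.1 a)
  have h2 := key a (g.1 a)
  simp only [lt_irrefl, false_iff, iff_false, not_lt] at h1 h2
  exact le_antisymm h2 h1

theorem finite (hn : 0 < n) : Finite (Bound k n) := by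
  let φ : Bound k n → (Fin n → Finset.Icc (0 : ℤ) n) := fun f c =>
    ⟨f.1 (c + 1) - (c + 1), by
      have h1 := f.le_apply (c + 1)
      have h2 := f.apply_le (c + 1)
      rw [Finset.mem_Icc]
      omega⟩
  refine Finite.of_injective φ fun f g h => Subtype.ext (Equiv.ext fun m => ?_)
  obtain ⟨i, r, h1, h2, rfl⟩ := exists_mem_Icc_add_mul hn m
  rw [f.isAffine.apply_add_mul, g.isAffine.apply_add_mul]
  have := congrArg Subtype.val (congrFun h ⟨(i - 1).toNat, by omega⟩)
  simp only [φ] at this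
  have e : (((i - 1).toNat : ℕ) : ℤ) + 1 = i := by omega
  rw [e] at this
  linarith

end Bound

end Positroid

namespace Positroid

/-! ### Elementary steps in `Bound(k,n)` and the rank criterion for the Bruhat order -/

/-- The hypothesis `hr` says that `(a, b)` lies in no translate of the rectangle `(i, j] × [f i, f
j)`. Together with `IsSwap.ncard_crossings_le`, crossing numbers are unchanged outside these
rectangles when `f i < f j`. -/
theorem IsSwap.ncard_crossings_mul_le {n : ℕ} (hn : 0 < n) {i j : ℤ} {t f : Equiv.Perm ℤ}
    (ht : IsSwap n i j t) (hf : IsAffine n f) {a b : ℤ}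
    (hr : ∀ r : ℤ, i + r * n < a → a ≤ j + r * n → f i + r * n ≤ b → f j + r * n ≤ b) :
    (crossings (f * t) a b).ncard ≤ (crossings f a b).ncard := by
  have hlt := ht.lt
  apply Set.ncard_le_ncard_of_injOn (fun c => if t c < a then t c else c) _ _
    (hf.finite_crossings hn a b)
  · rintro c ⟨h1, h2⟩
    simp only [Equiv.Perm.mul_apply] at h2
    by_cases h : t c < a
    · simp only [h, if_true]
      exact ⟨h, h2⟩
    · simp only [h, if_false]
      refine ⟨h1, ?_⟩
      by_cases hc : c ≡ i [ZMOD n]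
      · obtain ⟨r, rfl⟩ := exists_eq_add_mul_of_modEq hc
        have := hr r h1
        rw [ht.isAffine.apply_add_mul, ht.left] at h h2
        rw [hf.apply_add_mul] at h2 ⊢
        omega
      by_cases hc' : c ≡ j [ZMOD n]
      · have := ht.apply_right c hc'
        omega
      · rw [ht.apply_of_not c hc hc'] at h
        omega
  · rintro c ⟨h1, h2⟩ d ⟨h3, h4⟩ he
    by_cases h : t c < a <;> by_cases h' : t d < a <;> simp only [h, h', if_true, if_false] at he
    · exact t.injective he
    · rw [← he, ht.apply_apply] at h'
      exact absurd h1 h'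
    · rw [he, ht.apply_apply] at h
      exact absurd h3 h
    · exact he

/-- Since `j - i < n`, at most one translate of `i` is carried by `t` across the position `a`, and
only that one can be a new crossing. -/
theorem IsSwap.ncard_crossings_mul_le_add_one {n : ℕ} (hn : 0 < n) {i j : ℤ}
    {t f : Equiv.Perm ℤ} (ht : IsSwap n i j t) (hf : IsAffine n f) (hjn : j < i + n) (a b : ℤ) :
    (crossings (f * t) a b).ncard ≤ (crossings f a b).ncard + 1 := by
  have hn' : (0 : ℤ) < n := by exact_mod_cast hn
  have hlt := ht.lt
  have hfin := (hf.mul ht.isAffine).finite_crossings hn a b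
  -- The only integer `r` with `i + r n < a ≤ i + (r + 1) n`.
  let r := (a - i - 1) / (n : ℤ)
  have hr : ∀ q : ℤ, i + q * n < a → a ≤ j + q * n → i + q * n = i + r * n := by
    intro q h1 h2
    have : r = q := by
      refine ((Int.ediv_emod_unique hn' (r := a - i - 1 - q * n)).2 ⟨by ring, ?_, ?_⟩).1 <;> omega
    rw [this]
  suffices h : ((crossings (f * t) a b) \ {i + r * n}).ncard ≤ (crossings f a b).ncard by
    have := Set.ncard_le_ncard_sdiff_add_ncard (crossings (f * t) a b) {i + r * n}
    rw [Set.ncard_singleton] at this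
    omega
  apply Set.ncard_le_ncard_of_injOn (fun c => if t c < a then t c else c) _ _
    (hf.finite_crossings hn a b)
  · rintro c ⟨⟨h1, h2⟩, h3⟩
    simp only [Equiv.Perm.mul_apply] at h2
    by_cases h : t c < a
    · simp only [h, if_true]
      exact ⟨h, h2⟩
    · exfalso
      by_cases hc : c ≡ i [ZMOD n]
      · obtain ⟨q, rfl⟩ := exists_eq_add_mul_of_modEq hc
        rw [ht.isAffine.apply_add_mul, ht.left] at h
        exact h3 (hr q h1 (by omega))
      by_cases hc' : c ≡ j [ZMOD n]
      · have := ht.apply_right c hc'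
        omega
      · rw [ht.apply_of_not c hc hc'] at h
        omega
  · rintro c ⟨⟨h1, h2⟩, -⟩ d ⟨⟨h3, h4⟩, -⟩ he
    by_cases h : t c < a <;> by_cases h' : t d < a <;> simp only [h, h', if_true, if_false] at he
    · exact t.injective he
    · rw [← he, ht.apply_apply] at h'
      exact absurd h1 h'
    · rw [he, ht.apply_apply] at h
      exact absurd h3 h
    · exact he

namespace Bound

variable {k n : ℕ}

/-- `g = f t` for the swap `t` of `i < j`, where `j ≤ f(i) < f(j) ≤ i + n`. -/
structure StepTo (f g : Bound k n) (i j : ℤ) : Prop where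
  lt : i < j
  le : j ≤ f.1 i
  apply_lt : f.1 i < f.1 j
  apply_le : f.1 j ≤ i + n
  exists_swap : ∃ t, IsSwap n i j t ∧ g.1 = f.1 * t

/-- The outer inequalities `j ≤ f i` and `f j ≤ i + n` are exactly what keeps `f t` bounded. -/
theorem exists_stepTo (hn : 0 < n) (f : Bound k n) {i j : ℤ} (h1 : i < j) (h2 : j ≤ f.1 i)
    (h3 : f.1 i < f.1 j) (h4 : f.1 j ≤ i + n) : ∃ g : Bound k n, StepTo f g i j := by
  have hmod : ¬ i ≡ j [ZMOD n] := by
    intro h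
    have := Int.le_of_dvd (by omega) (Int.modEq_iff_dvd.1 h)
    omega
  obtain ⟨t, ht⟩ := exists_isSwap h1 hmod
  have hb : ∀ m, m ≤ (f.1 * t) m ∧ (f.1 * t) m ≤ m + n := by
    intro m
    simp only [Equiv.Perm.mul_apply]
    by_cases hc : m ≡ i [ZMOD n]
    · obtain ⟨r, rfl⟩ := exists_eq_add_mul_of_modEq hc
      rw [ht.isAffine.apply_add_mul, ht.left, f.isAffine.apply_add_mul]
      omega
    by_cases hc' : m ≡ j [ZMOD n]
    · obtain ⟨r, rfl⟩ := exists_eq_add_mul_of_modEq hc'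
      rw [ht.isAffine.apply_add_mul, ht.right, f.isAffine.apply_add_mul]
      omega
    · rw [ht.apply_of_not m hc hc']
      exact ⟨f.le_apply m, f.apply_le m⟩
  have hft := f.isAffine.mul ht.isAffine
  refine ⟨⟨f.1 * t, hft, hb, ?_⟩, h1, h2, h3, h4, t, ht, rfl⟩
  rw [sum_displacement_eq hn hft hb]
  -- The ball number is read off at `(a, a - 1)`. No translate of the rectangle contains such a
  -- point, because `j ≤ f i`.
  have hk : ∀ a, (crossings (f.1 * t) a (a - 1)).ncard = k := by
    intro a
    refine Eq.trans ?_ (f.ncard_crossings_diag hn a)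
    apply le_antisymm
    · apply ht.ncard_crossings_mul_le hn f.isAffine
      intro r _ _ _
      omega
    · exact ht.ncard_crossings_le hn f.isAffine h3 _ _
  rw [Finset.sum_congr rfl fun i _ => congrArg Nat.cast (hk i), Finset.sum_const, Int.card_Icc,
    nsmul_eq_mul]
  simp

theorem StepTo.length_lt (hn : 0 < n) {f g : Bound k n} {i j : ℤ} (h : StepTo f g i j) :
    length n f.1 < length n g.1 := by
  obtain ⟨t, ht, hg⟩ := h.exists_swap
  rw [hg]
  exact ht.length_lt hn f.isAffine h.apply_lt

/-- Induction along elementary steps, from the longest elements of `Bound(k,n)` downwards. -/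
theorem step_induction (hn : 0 < n) {P : Bound k n → Prop}
    (h : ∀ f, (∀ g i j, StepTo f g i j → P g) → P f) (f : Bound k n) : P f := by
  have := Bound.finite (k := k) hn
  obtain ⟨M, hM⟩ := (Set.finite_range fun f : Bound k n => length n f.1).bddAbove
  have hM' : ∀ f : Bound k n, length n f.1 ≤ M := fun f => hM ⟨f, rfl⟩
  have key : ∀ (m : ℕ) (f : Bound k n), M - length n f.1 < m → P f := by
    intro m
    induction m with
    | zero => intro f hf; omega
    | succ m ih =>
      intro f hf
      refine h f fun g i j hg => ih g ?_
      have := hg.length_lt hn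
      have := hM' g
      omega
  exact key _ f (Nat.lt_succ_self _)

/-- If the rank matrix of `g` is bounded by that of `f ≠ g`, it is strictly smaller on the
rectangle of some elementary step from `f`. -/
theorem exists_rectangle (hn : 0 < n) {f g : Bound k n}
    (hle : ∀ a b, rankMatrix g a b ≤ rankMatrix f a b) (hne : f ≠ g) :
    ∃ i j, i < j ∧ j ≤ f.1 i ∧ f.1 i < f.1 j ∧ f.1 j ≤ i + n ∧
      ∀ x b, i < x → x ≤ j → f.1 i ≤ b → b < f.1 j → rankMatrix g x b < rankMatrix f x b := by
  classical
  let D : ℤ → ℤ → ℤ := fun a b => rankMatrix f a b - rankMatrix g a b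
  have hD0 : ∀ a b, 0 ≤ D a b := fun a b => sub_nonneg.2 (hle a b)
  have hDs : ∀ a b, D (a + 1) b =
      D a b + (if b < g.1 a then 1 else 0) - if b < f.1 a then 1 else 0 := by
    intro a b
    have h1 := f.rankMatrix_sub hn a b
    have h2 := g.rankMatrix_sub hn a b
    simp only [D]
    linarith
  have hDlt : ∀ a b, b < a → D a b = 0 := fun a b h => by
    simp only [D, f.rankMatrix_of_lt hn h, g.rankMatrix_of_lt hn h, sub_self]
  have hDge : ∀ a b : ℤ, a + n ≤ b + 1 → D a b = 0 := fun a b h => by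
    simp only [D, f.rankMatrix_of_le h, g.rankMatrix_of_le h, sub_self]
  -- a horizontal unit step where `D` becomes positive
  obtain ⟨i, b₀, hi0, hi1⟩ : ∃ i b₀, D i b₀ = 0 ∧ 0 < D (i + 1) b₀ := by
    by_contra hcon
    push Not at hcon
    refine hne (ext_of_rankMatrix hn fun a b => sub_eq_zero.1 ?_)
    change D a b = 0
    have key : ∀ m : ℕ, D (b + 1 - n + m) b = 0 := by
      intro m
      induction m with
      | zero => exact hDge _ _ (by simp)
      | succ m ih =>
        push_cast
        rw [← add_assoc]
        exact le_antisymm (hcon _ _ ih) (hD0 _ _)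
    rcases le_or_gt (a + n) (b + 1) with h | h
    · exact hDge a b h
    · have := key (a - (b + 1 - n)).toNat
      have e : b + 1 - n + ((a - (b + 1 - n)).toNat : ℤ) = a := by omega
      rwa [e] at this
  have hs := hDs i b₀
  have hgb : b₀ < g.1 i := by
    by_contra h
    rw [if_neg h] at hs
    split_ifs at hs <;> omega
  have hfb : f.1 i ≤ b₀ := by
    by_contra h
    rw [if_pos hgb, if_pos (by omega)] at hs
    omega
  -- the first zero above `b₀` on the line `i + 1`
  have hB : ∃ m : ℕ, D (i + 1) (b₀ + m) = 0 :=
    ⟨(i + 1 + n - b₀).toNat, hDge _ _ (by omega)⟩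
  obtain ⟨B, hB0, hBm, hbB⟩ : ∃ B, D (i + 1) B = 0 ∧ (∀ b, b₀ ≤ b → b < B → 0 < D (i + 1) b) ∧
      b₀ ≤ B := by
    refine ⟨b₀ + Nat.find hB, Nat.find_spec hB, ?_, by omega⟩
    intro b h1 h2
    have := Nat.find_min hB (m := (b - b₀).toNat) (by omega)
    have e : b₀ + ((b - b₀).toNat : ℤ) = b := by omega
    rw [e] at this
    exact lt_of_le_of_ne (hD0 _ _) (Ne.symm this)
  -- Below `b₀` the step from `i` to `i + 1` also raises `D` by one, since `f i ≤ b < g i`.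
  have hpos : ∀ b, f.1 i ≤ b → b < B → 1 ≤ D (i + 1) b := by
    intro b h1 h2
    rcases le_or_gt b₀ b with h | h
    · exact hBm b h h2
    · rw [hDs, if_pos (by omega), if_neg (by omega)]
      have := hD0 i b
      omega
  -- as long as no value of `f` lies in `(f i, B]`, positivity propagates to the right
  have hprop : ∀ x, i < x → (∀ c, i < c → c < x → f.1 c ≤ f.1 i ∨ B < f.1 c) →
      ∀ b, f.1 i ≤ b → b < B → D (i + 1) b - D (i + 1) B ≤ D x b - D x B := by
    intro x hx
    induction x, (show i + 1 ≤ x by omega) using Int.leInduction with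
    | base => intro _ b _ _; exact le_rfl
    | succ x hx' ih =>
      intro hc b h1 h2
      have h3 := ih (by omega) (fun c h4 h5 => hc c h4 (by omega)) b h1 h2
      have h6 := hc x (by omega) (by omega)
      rw [hDs x b, hDs x B]
      have h7 : (if b < f.1 x then (1 : ℤ) else 0) = if B < f.1 x then 1 else 0 :=
        if_congr (by omega) rfl rfl
      have h8 : (if B < g.1 x then (1 : ℤ) else 0) ≤ if b < g.1 x then 1 else 0 := by
        split_ifs <;> omega
      omega
  -- Without such a column, positivity would propagate to the entry `(f i + 1, f i)`, where both
  -- rank matrices are prescribed and `D` vanishes.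
  have hj : ∃ m : ℕ, f.1 i < f.1 (i + 1 + m) ∧ f.1 (i + 1 + m) ≤ B := by
    by_contra hcon
    push Not at hcon
    have hiB : f.1 i < B := by
      rcases hbB.lt_or_eq with h | h
      · omega
      · rw [h] at hi1; omega
    have hi := f.le_apply i
    have h1 := hprop (f.1 i + 1) (by omega) (fun c h4 h5 => by
      have := hcon (c - i - 1).toNat
      have e : i + 1 + ((c - i - 1).toNat : ℤ) = c := by omega
      rw [e] at this
      omega) (f.1 i) le_rfl hiB
    have h2 := hpos _ le_rfl hiB
    rw [hDlt (f.1 i + 1) (f.1 i) (by omega)] at h1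
    have := hD0 (f.1 i + 1) B
    omega
  obtain ⟨j, hij, hfj, hjB, hjm⟩ : ∃ j, i < j ∧ f.1 i < f.1 j ∧ f.1 j ≤ B ∧
      ∀ c, i < c → c < j → f.1 c ≤ f.1 i ∨ B < f.1 c := by
    refine ⟨i + 1 + Nat.find hj, by omega, (Nat.find_spec hj).1, (Nat.find_spec hj).2, ?_⟩
    intro c h1 h2
    have := Nat.find_min hj (m := (c - i - 1).toNat) (by omega)
    have e : i + 1 + ((c - i - 1).toNat : ℤ) = c := by omega
    rw [e] at this
    omega
  have hrect : ∀ x b, i < x → x ≤ j → f.1 i ≤ b → b < f.1 j → 0 < D x b := by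
    intro x b h1 h2 h3 h4
    have h5 := hprop x h1 (fun c h6 h7 => hjm c h6 (by omega)) b h3 (by omega)
    have h6 := hpos b h3 (by omega)
    have h7 := hD0 x B
    omega
  -- The two remaining bounds hold because `D` vanishes for `b < a` and for `a + n ≤ b + 1`, so the
  -- rectangle avoids both regions.
  refine ⟨i, j, hij, ?_, hfj, ?_, fun x b h1 h2 h3 h4 => sub_pos.1 (hrect x b h1 h2 h3 h4)⟩
  · by_contra h
    have := hrect j (f.1 i) hij le_rfl le_rfl hfj
    rw [hDlt _ _ (by omega)] at this
    omega
  · by_contra h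
    have := hrect (i + 1) (f.1 j - 1) (by omega) (by omega) (by omega) (by omega)
    rw [hDge _ _ (by omega)] at this
    omega

/-- The rank criterion: if the rank matrix of `g` is bounded by that of `f`, then `g` is reached
from `f` by elementary steps. -/
theorem reflTransGen_of_rankMatrix_le (hn : 0 < n) (f g : Bound k n)
    (hle : ∀ a b, rankMatrix g a b ≤ rankMatrix f a b) :
    Relation.ReflTransGen (fun f g : Bound k n => ∃ i j, StepTo f g i j) f g := by
  induction f using step_induction hn with
  | h f ih =>
    by_cases hne : f = g
    · rw [hne]
    obtain ⟨i, j, h1, h2, h3, h4, h5⟩ := exists_rectangle hn hle hne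
    obtain ⟨f', hf'⟩ := exists_stepTo hn f h1 h2 h3 h4
    refine Relation.ReflTransGen.head ⟨i, j, hf'⟩ (ih f' i j hf' fun a b => ?_)
    obtain ⟨t, ht, htf⟩ := hf'.exists_swap
    -- Inside a translated rectangle the rank drops by at most one, which the strict inequality `h5`
    -- allows; elsewhere it does not drop.
    by_cases hr : ∃ r : ℤ, i + r * n < a ∧ a ≤ j + r * n ∧ f.1 i + r * n ≤ b ∧ b < f.1 j + r * n
    · obtain ⟨r, h6, h7, h8, h9⟩ := hr
      have h10 := h5 (a + -r * n) (b + -r * n) (by linarith) (by linarith) (by linarith)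
        (by linarith)
      rw [rankMatrix_add, rankMatrix_add] at h10
      have h11 := ht.ncard_crossings_mul_le_add_one hn f.isAffine (by omega) a b
      rw [← htf] at h11
      rw [rankMatrix_eq] at h10
      rw [rankMatrix_eq] at h10
      rw [rankMatrix_eq, rankMatrix_eq]
      omega
    · have h11 := ht.ncard_crossings_mul_le hn f.isAffine (a := a) (b := b)
        (fun r h6 h7 h8 => by
          by_contra h9
          exact hr ⟨r, h6, h7, h8, by omega⟩)
      have h10 := hle a b
      rw [← htf] at h11
      rw [rankMatrix_eq] at h10
      rw [rankMatrix_eq] at h10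
      rw [rankMatrix_eq, rankMatrix_eq]
      omega

/-- `f ≤ g` in the Bruhat order if and only if the rank matrix of `g` is bounded by that
of `f`. -/
theorem bruhatLE_iff (hn : 0 < n) (f g : Bound k n) :
    BruhatLE n f.1 g.1 ↔ ∀ a b, rankMatrix g a b ≤ rankMatrix f a b := by
  constructor
  · intro h a b
    have := (h.isAffine_and_ncard_crossings_le hn f.isAffine).2 a b
    rw [rankMatrix_eq, rankMatrix_eq]
    omega
  · intro h
    have := reflTransGen_of_rankMatrix_le hn f g h
    refine this.lift (fun f : Bound k n => f.1) ?_
    rintro f g ⟨i, j, hs⟩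
    obtain ⟨t, ht, hg⟩ := hs.exists_swap
    exact ⟨t, ht.isReflection, hg, hs.length_lt hn⟩

/-- Unless `f(i) ∈ {i, i + n}` for all `i`, there is an elementary step from `f`. -/
theorem exists_stepTo_of_ne (hn : 0 < n) (f : Bound k n) {c : ℤ} (h1 : f.1 c ≠ c)
    (h2 : f.1 c ≠ c + n) : ∃ g i j, StepTo f g i j := by
  let p : ℤ → Prop := fun c => f.1 c ≠ c ∧ f.1 c ≠ c + n
  have hp : ∀ c, p c → p (f.1 c) := by
    rintro c ⟨h1, h2⟩
    refine ⟨fun h => h1 (f.1.injective h), fun h => h2 ?_⟩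
    rw [← f.isAffine c] at h
    exact f.1.injective h
  have hp' : ∀ c, p c → p (c - n) := by
    rintro c ⟨h1, h2⟩
    have := f.isAffine (c - n)
    rw [sub_add_cancel] at this
    exact ⟨by omega, by omega⟩
  have hex : ∃ m : ℕ, ∃ i, p i ∧ (f.1 i - i).toNat = m := ⟨_, c, ⟨h1, h2⟩, rfl⟩
  classical
  obtain ⟨i, hi, him⟩ := Nat.find_spec hex
  -- Minimality of the displacement of `i` gives `f i < f j` for every `j > i` satisfying `p`, so
  -- such a `j ≤ f i` yields a step unless `f j > i + n`.
  have hmin : ∀ j, p j → f.1 i - i ≤ f.1 j - j := by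
    intro j hj
    have := Nat.find_min' hex ⟨j, hj, rfl⟩
    have := f.le_apply i
    have := f.le_apply j
    omega
  by_contra hcon
  have hbig : ∀ j, p j → i < j → j ≤ f.1 i → i + n < f.1 j := by
    intro j hj h3 h4
    by_contra h5
    have := hmin j hj
    obtain ⟨g, hg⟩ := exists_stepTo hn f h3 h4 (by omega) (by omega)
    exact hcon ⟨g, i, j, hg⟩
  -- Without a step, `j ↦ f j - n` would map the elements of `(i, f i]` satisfying `p` to strictly
  -- smaller ones in the same interval: infinite descent, starting at `f i`.
  have key : ∀ (m : ℕ) (j : ℤ), p j → i < j → j ≤ f.1 i → j - i < m → False := by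
    intro m
    induction m with
    | zero => intro j _ _ _ _; omega
    | succ m ih =>
      intro j hj h3 h4 h5
      have h6 := hbig j hj h3 h4
      have h7 := f.apply_le j
      have h8 := hj.2
      exact ih (f.1 j - n) (hp' _ (hp j hj)) (by omega) (by omega) (by omega)
  have hii := f.le_apply i
  have hi1 := hi.1
  exact key (f.1 i - i + 1).toNat (f.1 i) (hp i hi) (by omega) le_rfl (by omega)

end Bound

end Positroid

namespace Positroid

/-! ### Ranks of intervals in a sequence of vectors -/

section Span

variable {E : Type*} [AddCommGroup E] [Module ℂ E]

/-- The span of `v a, …, v b`. -/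
def intervalSpan (v : ℤ → E) (a b : ℤ) : Submodule ℂ E := Submodule.span ℂ (v '' Set.Icc a b)

theorem mem_intervalSpan (v : ℤ → E) {a b c : ℤ} (h1 : a ≤ c) (h2 : c ≤ b) :
    v c ∈ intervalSpan v a b :=
  Submodule.subset_span ⟨c, ⟨h1, h2⟩, rfl⟩

theorem intervalSpan_mono (v : ℤ → E) {a b a' b' : ℤ} (h1 : a' ≤ a) (h2 : b ≤ b') :
    intervalSpan v a b ≤ intervalSpan v a' b' :=
  Submodule.span_mono (Set.image_mono (Set.Icc_subset_Icc h1 h2))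

theorem intervalSpan_le {v : ℤ → E} {a b : ℤ} {p : Submodule ℂ E}
    (h : ∀ c, a ≤ c → c ≤ b → v c ∈ p) : intervalSpan v a b ≤ p := by
  refine Submodule.span_le.2 ?_
  rintro _ ⟨c, ⟨h1, h2⟩, rfl⟩
  exact h c h1 h2

theorem intervalSpan_congr {v w : ℤ → E} {a b : ℤ} (h : ∀ c, a ≤ c → c ≤ b → v c = w c) :
    intervalSpan v a b = intervalSpan w a b := by
  unfold intervalSpan
  rw [Set.image_congr fun c hc => h c hc.1 hc.2]

theorem intervalSpan_of_lt (v : ℤ → E) {a b : ℤ} (h : b < a) : intervalSpan v a b = ⊥ := by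
  simp [intervalSpan, Set.Icc_eq_empty (not_le.2 h)]

theorem intervalSpan_left (v : ℤ → E) {a b : ℤ} (h : a ≤ b) :
    intervalSpan v a b = Submodule.span ℂ (insert (v a) (v '' Set.Icc (a + 1) b)) := by
  rw [← Set.image_insert_eq]
  unfold intervalSpan
  congr 2
  ext c
  simp only [Set.mem_Icc, Set.mem_insert_iff]
  omega

theorem intervalSpan_right (v : ℤ → E) {a b : ℤ} (h : a ≤ b) :
    intervalSpan v a b = Submodule.span ℂ (insert (v b) (v '' Set.Icc a (b - 1))) := by
  rw [← Set.image_insert_eq]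
  unfold intervalSpan
  congr 2
  ext c
  simp only [Set.mem_Icc, Set.mem_insert_iff]
  omega

theorem intervalSpan_add_mul {n : ℕ} {v : ℤ → E} (hv : ∀ m, v (m + n) = v m) (a b r : ℤ) :
    intervalSpan v (a + r * n) (b + r * n) = intervalSpan v a b := by
  have hv' : ∀ m, v (m + r * n) = v m := by
    intro m
    have : Function.Periodic v (n : ℤ) := hv
    simpa using this.int_mul r m
  unfold intervalSpan
  congr 1
  ext x
  constructor
  · rintro ⟨c, ⟨h1, h2⟩, rfl⟩
    refine ⟨c + -r * n, ⟨by linarith, by linarith⟩, ?_⟩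
    rw [← hv' (c + -r * n)]
    congr 1; ring
  · rintro ⟨c, ⟨h1, h2⟩, rfl⟩
    exact ⟨c + r * n, ⟨by linarith, by linarith⟩, hv' c⟩

/-- The rank of `v a, …, v b`. -/
noncomputable def intervalRank (v : ℤ → E) (a b : ℤ) : ℕ := Module.finrank ℂ (intervalSpan v a b)

theorem finrank_span_insert_of_notMem [FiniteDimensional ℂ E] {x : E} {s : Set E}
    (h : x ∉ Submodule.span ℂ s) :
    Module.finrank ℂ (Submodule.span ℂ (insert x s)) =
      Module.finrank ℂ (Submodule.span ℂ s) + 1 := by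
  have hx : x ≠ 0 := fun h0 => h (h0 ▸ Submodule.zero_mem _)
  rw [Submodule.span_insert]
  have h1 := Submodule.finrank_sup_add_finrank_inf_eq (Submodule.span ℂ {x}) (Submodule.span ℂ s)
  have h2 : Submodule.span ℂ {x} ⊓ Submodule.span ℂ s = ⊥ :=
    disjoint_iff.1 ((Submodule.disjoint_span_singleton' hx).2 h).symm
  rw [h2, finrank_bot, finrank_span_singleton hx] at h1
  omega

open Classical in
theorem intervalRank_succ [FiniteDimensional ℂ E] (v : ℤ → E) {a b : ℤ} (h : a ≤ b) :
    intervalRank v a b =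
      intervalRank v (a + 1) b + if v a ∈ intervalSpan v (a + 1) b then 0 else 1 := by
  unfold intervalRank
  rw [intervalSpan_left v h]
  split_ifs with hm
  · rw [Submodule.span_insert_eq_span hm, add_zero]
    rfl
  · exact finrank_span_insert_of_notMem hm

/-- `f(a)` is the least `b ≥ a` such that `v a` lies in the span of `v (a + 1), …, v b`. -/
def IsFirstReturn (v : ℤ → E) (f : ℤ → ℤ) : Prop :=
  ∀ a b, a ≤ b → (v a ∈ intervalSpan v (a + 1) b ↔ f a ≤ b)

theorem IsFirstReturn.intervalRank_succ [FiniteDimensional ℂ E] {v : ℤ → E} {f : ℤ → ℤ}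
    (hf : IsFirstReturn v f) {a b : ℤ} (h : a ≤ b) :
    intervalRank v a b = intervalRank v (a + 1) b + if b < f a then 1 else 0 := by
  classical
  rw [Positroid.intervalRank_succ v h, hf a b h]
  by_cases hb : f a ≤ b
  · simp [hb]
  · simp [hb, not_le.1 hb]

/-- The first return map of a periodic sequence is an affine permutation. -/
theorem exists_isFirstReturn {n : ℕ} (hn : 0 < n) (v : ℤ → E) (hv : ∀ m, v (m + n) = v m) :
    ∃ f : Equiv.Perm ℤ, IsFirstReturn v f ∧ IsAffine n f ∧ ∀ i, i ≤ f i ∧ f i ≤ i + n := by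
  classical
  have hex : ∀ a, ∃ d : ℕ, v a ∈ intervalSpan v (a + 1) (a + d) := fun a =>
    ⟨n, by rw [← hv a]; exact mem_intervalSpan v (by omega) le_rfl⟩
  let F : ℤ → ℤ := fun a => a + Nat.find (hex a)
  have hFa : ∀ a, a ≤ F a := fun a => by simp [F]
  have hF : ∀ a b, a ≤ b → (v a ∈ intervalSpan v (a + 1) b ↔ F a ≤ b) := by
    intro a b hab
    constructor
    · intro h
      have := Nat.find_min' (hex a) (m := (b - a).toNat) (by
        have e : a + ((b - a).toNat : ℤ) = b := by omega
        rwa [e])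
      simp only [F]
      omega
    · intro h
      exact intervalSpan_mono v le_rfl h (Nat.find_spec (hex a))
  have hFn : ∀ a, F a ≤ a + n := fun a => by
    rw [← hF a _ (by omega), ← hv a]
    exact mem_intervalSpan v (by omega) le_rfl
  have hFadd : ∀ a, F (a + n) = F a + n := by
    intro a
    have key : ∀ b, a ≤ b → (F (a + n) ≤ b + n ↔ F a ≤ b) := by
      intro b hb
      rw [← hF _ _ (by omega), ← hF _ _ hb, hv]
      have := intervalSpan_add_mul hv (a + 1) b 1
      rw [one_mul] at this
      rw [← this]
      have e : a + n + 1 = a + 1 + (n : ℤ) := by ring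
      rw [e]
    have h1 := (key (F a) (hFa a)).2 le_rfl
    have h2 := (key (F (a + n) - n) (by have := hFa (a + n); omega)).1 (by omega)
    omega
  -- By exchange: `v (F a)` is the vector that first makes `v a` dependent, so `v a` has a nonzero
  -- coefficient in the relation. If `F a = a`, then `v a = 0` and the span is that of the empty
  -- set.
  have hmem : ∀ a, v (F a) ∈ intervalSpan v a (F a - 1) := by
    intro a
    have h1 := (hF a (F a) (hFa a)).2 le_rfl
    rcases (hFa a).eq_or_lt with h | h
    · rw [← h, intervalSpan_of_lt v (by omega), Submodule.mem_bot] at h1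
      rw [← h, h1]
      exact Submodule.zero_mem _
    · have h2 : v a ∉ intervalSpan v (a + 1) (F a - 1) := by
        rw [hF a _ (by omega)]; omega
      rw [intervalSpan_right v (by omega)] at h1
      rw [intervalSpan_left v (by omega)]
      exact mem_span_insert_exchange h1 h2
  have hnotMem : ∀ a, a < F a → v (F a) ∉ intervalSpan v (a + 1) (F a - 1) := by
    intro a h h1
    have h2 := (hF a (F a) (hFa a)).2 le_rfl
    rw [intervalSpan_right v (by omega), Submodule.span_insert_eq_span h1] at h2
    have := (hF a (F a - 1) (by omega)).1 h2
    omega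
  -- By `hmem` and `hnotMem`, when `a < F a`, `a` is the largest start of an interval ending at `F a
  -- - 1` whose span contains `v (F a)`.
  have hinj : Function.Injective F := by
    have key : ∀ a a', a < a' → F a ≠ F a' := by
      intro a a' haa he
      have h1 := hmem a'
      have h2 := hFa a'
      rw [← he] at h1 h2
      exact hnotMem a (by omega) (intervalSpan_mono v (by omega) le_rfl h1)
    intro a a' he
    rcases lt_trichotomy a a' with h | h | h
    · exact absurd he (key a a' h)
    · exact h
    · exact absurd he.symm (key a' a h)
  -- The preimage of `b` is the largest `a ≤ b` with `v b` in the span of `v a, …, v (b - 1)`;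
  -- exchange turns this into a first return from `a` to `b`.
  have hsurj : Function.Surjective F := by
    intro b
    have hb : ∃ d : ℕ, v b ∈ intervalSpan v (b - d) (b - 1) := ⟨n, by
      have := hv (b - n)
      rw [sub_add_cancel] at this
      rw [this]
      exact mem_intervalSpan v le_rfl (by omega)⟩
    have h1 := Nat.find_spec hb
    refine ⟨b - Nat.find hb, ?_⟩
    by_cases h0 : Nat.find hb = 0
    · rw [h0] at h1
      rw [h0]
      rw [intervalSpan_of_lt v (by simp), Submodule.mem_bot] at h1
      simp only [Nat.cast_zero, sub_zero]
      have := (hF b b le_rfl).1 (by rw [h1]; exact Submodule.zero_mem _)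
      have := hFa b
      omega
    · have h2 := Nat.find_min hb (m := Nat.find hb - 1) (by omega)
      set a : ℤ := b - Nat.find hb with ha
      have e : b - ((Nat.find hb - 1 : ℕ) : ℤ) = a + 1 := by omega
      rw [e] at h2
      rw [intervalSpan_left v (by omega)] at h1
      have h3 := mem_span_insert_exchange h1 h2
      have h4 := (hF a b (by omega)).1 (by rw [intervalSpan_right v (by omega)]; exact h3)
      by_contra hne
      have h5 := (hF a (b - 1) (by omega)).2 (by omega)
      rw [Submodule.span_insert_eq_span h5] at h1
      exact h2 h1
  exact ⟨Equiv.ofBijective F ⟨hinj, hsurj⟩, hF, hFadd, fun i => ⟨hFa i, hFn i⟩⟩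

end Span

/-! ### The columns of a matrix with given row space -/

section Columns

variable {k n : ℕ}

/-- The residue class of `m`, as an index of a column. -/
def colIndex (hn : 0 < n) (m : ℤ) : Fin n :=
  ⟨((m - 1) % n).toNat, by
    have hn' : (0 : ℤ) < n := by exact_mod_cast hn
    have h1 := Int.emod_nonneg (m - 1) hn'.ne'
    have h2 := Int.emod_lt_of_pos (m - 1) hn'
    omega⟩

theorem colIndex_modEq (hn : 0 < n) (m : ℤ) : m ≡ ((colIndex hn m : ℕ) : ℤ) + 1 [ZMOD n] := by
  have hn' : (0 : ℤ) < n := by exact_mod_cast hn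
  have h1 := Int.emod_nonneg (m - 1) hn'.ne'
  have e : ((colIndex hn m : ℕ) : ℤ) = (m - 1) % n := by
    simp only [colIndex]; omega
  rw [e]
  have := (Int.mod_modEq (m - 1) n).symm.add_right 1
  simpa using this

theorem eq_of_natCast_modEq {c d : Fin n} (h : ((c : ℕ) : ℤ) ≡ ((d : ℕ) : ℤ) [ZMOD n]) : c = d :=
  Fin.ext (Nat.ModEq.eq_of_lt_of_lt ((Int.natCast_modEq_iff).1 h) c.2 d.2)

theorem colIndex_eq_iff (hn : 0 < n) (m : ℤ) (c : Fin n) :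
    colIndex hn m = c ↔ m ≡ ((c : ℕ) : ℤ) + 1 [ZMOD n] := by
  constructor
  · rintro rfl
    exact colIndex_modEq hn m
  · intro h
    exact eq_of_natCast_modEq (((colIndex_modEq hn m).symm.trans h).add_right_cancel' 1)

theorem colIndex_add (hn : 0 < n) (m : ℤ) : colIndex hn (m + n) = colIndex hn m := by
  rw [colIndex_eq_iff]
  exact Int.ModEq.trans (by simp [Int.ModEq]) (colIndex_modEq hn m)

theorem colIndex_natCast_add_one (hn : 0 < n) (c : Fin n) : colIndex hn ((c : ℕ) + 1) = c :=
  (colIndex_eq_iff hn _ c).2 rfl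

/-- The columns of a matrix, extended periodically to a sequence indexed by `ℤ`. -/
def columns (hn : 0 < n) (A : Matrix (Fin k) (Fin n) ℂ) (m : ℤ) : Fin k → ℂ :=
  fun r => A r (colIndex hn m)

theorem columns_add (hn : 0 < n) (A : Matrix (Fin k) (Fin n) ℂ) (m : ℤ) :
    columns hn A (m + n) = columns hn A m := by
  unfold columns
  rw [colIndex_add]

/-- A periodic sequence of vectors is the sequence of columns of a matrix. -/
theorem columns_of_periodic (hn : 0 < n) {v : ℤ → Fin k → ℂ} (hv : ∀ m, v (m + n) = v m) :
    columns hn (Matrix.of fun r (c : Fin n) => v ((c : ℕ) + 1) r) = v := by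
  funext m r
  simp only [columns, Matrix.of_apply]
  obtain ⟨q, hq⟩ := exists_eq_add_mul_of_modEq (colIndex_modEq hn m)
  have : Function.Periodic v (n : ℤ) := hv
  have h := this.int_mul q (((colIndex hn m : ℕ) : ℤ) + 1)
  rw [Int.cast_id, ← hq] at h
  rw [h]

/-- Row rank equals column rank for the submatrix of the columns in `S`. -/
theorem projDim_eq_finrank_span {V : Gr k n} {A : Matrix (Fin k) (Fin n) ℂ}
    (hA : Submodule.span ℂ (Set.range A) = V.1) (S : Set (Fin n)) :
    projDim S V = Module.finrank ℂ (Submodule.span ℂ (A.transpose '' S)) := by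
  classical
  let B : Matrix (Fin k) S ℂ := A.submatrix id Subtype.val
  have h1 : V.1.map (LinearMap.funLeft ℂ ℂ (Subtype.val : S → Fin n)) =
      Submodule.span ℂ (Set.range B.row) := by
    rw [← hA, Submodule.map_span]
    exact congrArg (Submodule.span ℂ) (Set.range_comp _ A.row).symm
  have h2 : A.transpose '' S = Set.range B.col := by
    ext x
    constructor
    · rintro ⟨c, hc, rfl⟩
      exact ⟨⟨c, hc⟩, rfl⟩
    · rintro ⟨⟨c, hc⟩, rfl⟩
      exact ⟨c, hc, rfl⟩
  rw [projDim, h1, h2, ← Matrix.rank_eq_finrank_span_row, ← Matrix.rank_eq_finrank_span_cols]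

theorem span_range_basisMatrix (V : Gr k n) :
    Submodule.span ℂ (Set.range (basisMatrix V)) = V.1 := by
  have : Set.range (basisMatrix V) =
      V.1.subtype '' Set.range (Module.finBasisOfFinrankEq ℂ V.1 V.2) := by
    rw [← Set.range_comp]; rfl
  rw [this, ← Submodule.map_span, Module.Basis.span_eq, Submodule.map_top, Submodule.range_subtype]

theorem image_columns_Icc (hn : 0 < n) (A : Matrix (Fin k) (Fin n) ℂ) (a b : ℤ) :
    columns hn A '' Set.Icc a b = A.transpose ''
      {c : Fin n | ∃ m : ℤ, a ≤ m ∧ m ≤ b ∧ m ≡ ((c : ℕ) : ℤ) + 1 [ZMOD n]} := by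
  ext x
  constructor
  · rintro ⟨m, ⟨h1, h2⟩, rfl⟩
    exact ⟨colIndex hn m, ⟨m, h1, h2, colIndex_modEq hn m⟩, rfl⟩
  · rintro ⟨c, ⟨m, h1, h2, h3⟩, rfl⟩
    refine ⟨m, ⟨h1, h2⟩, ?_⟩
    rw [← (colIndex_eq_iff hn m c).2 h3]
    rfl

theorem cyclicRank_of_le (hn : 0 < n) {V : Gr k n} {A : Matrix (Fin k) (Fin n) ℂ}
    (hA : Submodule.span ℂ (Set.range A) = V.1) {a b : ℤ} (h : a ≤ b) :
    cyclicRank V a b = intervalRank (columns hn A) a b := by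
  rw [cyclicRank, if_neg (not_lt.2 h), projDim_eq_finrank_span hA, intervalRank, intervalSpan,
    image_columns_Icc]

theorem cyclicRank_of_full (hn : 0 < n) (V : Gr k n) {a b : ℤ} (h : a + n ≤ b + 1) :
    cyclicRank V a b = k := by
  have : {c : Fin n | ∃ m : ℤ, a ≤ m ∧ m ≤ b ∧ m ≡ ((c : ℕ) : ℤ) + 1 [ZMOD n]} = Set.univ := by
    ext c
    simp only [Set.mem_ofPred_eq, Set.mem_univ, iff_true]
    obtain ⟨i, r, h1, h2, h3⟩ := exists_mem_Icc_add_mul hn (((c : ℕ) : ℤ) + 1 - (a - 1))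
    refine ⟨a - 1 + i, by omega, by omega, Int.modEq_iff_dvd.2 ⟨r, ?_⟩⟩
    rw [mul_comm]
    linarith
  rw [cyclicRank, if_neg (by omega), this]
  have hinj : Function.Injective
      (LinearMap.funLeft ℂ ℂ (Subtype.val : ↥(Set.univ : Set (Fin n)) → Fin n)) :=
    LinearMap.funLeft_injective_of_surjective _ _ _ fun c => ⟨⟨c, trivial⟩, rfl⟩
  unfold projDim
  rw [← (Submodule.equivMapOfInjective _ hinj V.1).finrank_eq]
  exact_mod_cast V.2

/-- The increments of the cyclic rank matrix of `V` are given by the first return map of the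
columns of any matrix with row space `V`. -/
theorem cyclicRank_succ (hn : 0 < n) {V : Gr k n} {A : Matrix (Fin k) (Fin n) ℂ}
    (hA : Submodule.span ℂ (Set.range A) = V.1) {f : ℤ → ℤ} (hf : IsFirstReturn (columns hn A) f)
    (hle : ∀ i, i ≤ f i) (a b : ℤ) :
    cyclicRank V a b = cyclicRank V (a + 1) b + if b < f a then 1 else 0 := by
  rcases lt_trichotomy b a with h | rfl | h
  · rw [cyclicRank, cyclicRank, if_pos h, if_pos (by omega), if_pos (h.trans_le (hle a))]
    ring
  · rw [cyclicRank_of_le hn hA le_rfl, cyclicRank, if_pos (by omega), hf.intervalRank_succ le_rfl,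
      intervalRank, intervalSpan_of_lt _ (by omega), finrank_bot]
    push_cast
    ring
  · rw [cyclicRank_of_le hn hA h.le, cyclicRank_of_le hn hA (by omega), hf.intervalRank_succ h.le]
    push_cast
    rfl

theorem mem_openPositroidVariety_iff (hn : 0 < n) {V : Gr k n} {A : Matrix (Fin k) (Fin n) ℂ}
    (hA : Submodule.span ℂ (Set.range A) = V.1) (f : Bound k n) :
    V ∈ openPositroidVariety f ↔ IsFirstReturn (columns hn A) f.1 := by
  constructor
  · intro h
    obtain ⟨g, hg, hgn, hgb⟩ := exists_isFirstReturn hn (columns hn A) (columns_add hn A)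
    have hs := cyclicRank_succ hn hA hg (fun i => (hgb i).1)
    intro a b hab
    rw [hg a b hab, ← not_lt, ← not_lt, not_iff_not]
    have h1 := hs a b
    rw [h, h, f.rankMatrix_sub hn] at h1
    have := add_left_cancel h1
    by_cases h2 : b < g a <;> by_cases h3 : b < f.1 a <;>
      simp only [h2, h3, if_true, if_false, one_ne_zero, zero_ne_one] at this ⊢
  · intro h a b
    exact f.rankMatrix_unique hn (cyclicRank V) (cyclicRank_succ hn hA h f.le_apply)
      (fun a b h => cyclicRank_of_full hn V h) a b

theorem exists_mem_openPositroidVariety (hn : 0 < n) (V : Gr k n) :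
    ∃ f : Bound k n, V ∈ openPositroidVariety f := by
  have hA := span_range_basisMatrix V
  obtain ⟨g, hg, hgn, hgb⟩ := exists_isFirstReturn hn (columns hn (basisMatrix V)) (columns_add hn _)
  have hs := cyclicRank_succ hn hA hg (fun i => (hgb i).1)
  have hrank := eq_sub_ncard_crossings hn hgn (fun i => (hgb i).2) (cyclicRank V) hs
    (fun a b h => cyclicRank_of_full hn V h)
  refine ⟨⟨g, hgn, hgb, ?_⟩, (mem_openPositroidVariety_iff hn hA _).2 hg⟩
  rw [sum_displacement_eq hn hgn hgb]
  -- The convention `r_{ij} = j - i + 1` for `j < i` gives `r_{a,a-1} = 0`, so all these crossing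
  -- numbers are `k`.
  have hk : ∀ a, ((crossings g a (a - 1)).ncard : ℤ) = k := by
    intro a
    have := hrank a (a - 1)
    rw [cyclicRank, if_pos (by omega)] at this
    omega
  rw [Finset.sum_congr rfl fun i _ => hk i, Finset.sum_const, Int.card_Icc, nsmul_eq_mul]
  simp

end Columns

end Positroid

namespace Positroid

open Filter Topology

/-! ### Semicontinuity of ranks and deformations preserving linear relations. -/

section Deformation

variable {E : Type*} [NormedAddCommGroup E] [NormedSpace ℂ E]

/-- Lower semicontinuity of rank: linear independence of a finite family is an open condition. -/
theorem eventually_intervalRank_le [FiniteDimensional ℂ E] {ι : Type*} {l : Filter ι}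
    {u : ι → ℤ → E} {v : ℤ → E} (h : ∀ m, Tendsto (fun s => u s m) l (𝓝 (v m))) (a b : ℤ) :
    ∀ᶠ s in l, intervalRank v a b ≤ intervalRank (u s) a b := by
  obtain ⟨B, hB, -, hspan, hli⟩ := exists_linearIndepOn_extension
    (linearIndepOn_empty ℂ v) (Set.empty_subset (Set.Icc a b))
  have hfin : Finite B := (Set.finite_Icc a b).subset hB
  have := Fintype.ofFinite B
  have hlim : Tendsto (fun s (c : B) => u s c) l (𝓝 fun c : B => v c) :=
    tendsto_pi_nhds.2 fun c => h c
  have hli' : LinearIndependent ℂ (fun c : B => v c) := hli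
  filter_upwards [hlim.eventually hli'.eventually] with s hs
  have h1 : intervalRank v a b ≤ Fintype.card B := by
    rw [← finrank_span_eq_card hli', intervalRank]
    apply Submodule.finrank_mono
    rw [intervalSpan, Submodule.span_le]
    rwa [Set.image_eq_range v B] at hspan
  refine h1.trans ?_
  rw [← finrank_span_eq_card hs, intervalRank]
  apply Submodule.finrank_mono
  rw [Submodule.span_le]
  rintro _ ⟨c, rfl⟩
  exact mem_intervalSpan _ (hB c.2).1 (hB c.2).2

/-- Modulo the deformed vectors one has `v d ≡ -μ d • w d`, so the recursion becomes `(1 + x d * μ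
d) • w d ≡ w (d - 1)`. Thus every `w d` is a known multiple of `w c`. -/
theorem sub_prod_smul_mem_intervalSpan {v w : ℤ → E} {x μ : ℤ → ℂ} {c : ℤ}
    (hw : ∀ d, c < d → w d = w (d - 1) + x d • v d) {d : ℤ} (hcd : c ≤ d)
    (hne : ∀ e, c < e → e ≤ d → 1 + x e * μ e ≠ 0) :
    w d - (∏ e ∈ Finset.Ioc c d, (1 + x e * μ e)⁻¹) • w c ∈
      intervalSpan (fun e => v e + μ e • w e) (c + 1) d := by
  induction d, hcd using Int.leInduction with
  | base => simp
  | succ d hcd ih =>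
    have h1 := ih fun e h1 h2 => hne e h1 (by omega)
    have h2 := hne (d + 1) (by omega) le_rfl
    have h3 := hw (d + 1) (by omega)
    rw [add_sub_cancel_right] at h3
    have h4 : Finset.Ioc c (d + 1) = insert (d + 1) (Finset.Ioc c d) := by
      ext e; simp only [Finset.mem_Ioc, Finset.mem_insert]; omega
    rw [h4, Finset.prod_insert (by simp)]
    set P := ∏ e ∈ Finset.Ioc c d, (1 + x e * μ e)⁻¹
    set u : ℤ → E := fun e => v e + μ e • w e with hu
    have h5 : (1 + x (d + 1) * μ (d + 1)) • w (d + 1) = w d + x (d + 1) • u (d + 1) := by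
      simp only [hu, smul_add, smul_smul, add_smul, one_smul]
      nth_rewrite 1 [h3]
      abel
    have h6 : w (d + 1) - ((1 + x (d + 1) * μ (d + 1))⁻¹ * P) • w c =
        (1 + x (d + 1) * μ (d + 1))⁻¹ • ((w d - P • w c) + x (d + 1) • u (d + 1)) := by
      have : w (d + 1) = (1 + x (d + 1) * μ (d + 1))⁻¹ • (w d + x (d + 1) • u (d + 1)) := by
        rw [← h5, inv_smul_smul₀ h2]
      nth_rewrite 1 [this]
      rw [mul_smul, ← smul_sub]
      congr 1
      abel
    rw [h6]
    refine Submodule.smul_mem _ _ (Submodule.add_mem _ ?_ (Submodule.smul_mem _ _ ?_))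
    · exact intervalSpan_mono u le_rfl (by omega) h1
    · exact mem_intervalSpan u (by omega) le_rfl

theorem exists_sum_of_mem_intervalSpan {v : ℤ → E} {a b : ℤ} {z : E}
    (h : z ∈ intervalSpan v a b) : ∃ y : ℤ → ℂ, z = ∑ d ∈ Finset.Icc a b, y d • v d := by
  rw [intervalSpan, ← Finset.coe_Icc, Submodule.mem_span_image_finset_iff_exists_fun'] at h
  obtain ⟨y, hy⟩ := h
  exact ⟨y, hy.symm⟩

/-- A one-parameter deformation `v c + s λ_c(s) w c` of `v`, with `λ_j = 1` and `λ_c = 0` for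
`c > j`, that keeps the memberships `v c ∈ span (v (c + 1), …, v (G c))` for `i < c < j`. -/
theorem exists_deformation {v w : ℤ → E} {x : ℤ → ℂ} {i j : ℤ}
    (hw : ∀ c, i < c → w c = w (c - 1) + x c • v c) (G : ℤ → ℤ) :
    ∃ lam : ℂ → ℤ → ℂ, (∀ c, ContinuousAt (fun s => lam s c) 0) ∧ (∀ s c, j < c → lam s c = 0) ∧
      (∀ s, lam s j = 1) ∧ ∀ᶠ s in 𝓝 (0 : ℂ), ∀ c, i < c → c < j →
        v c ∈ intervalSpan v (c + 1) (G c) →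
        v c + (s * lam s c) • w c ∈
          intervalSpan (fun e => v e + (s * lam s e) • w e) (c + 1) (G c) := by
  suffices key : ∀ m : ℕ, ∃ lam : ℂ → ℤ → ℂ, (∀ c, ContinuousAt (fun s => lam s c) 0) ∧
      (∀ s c, j < c → lam s c = 0) ∧ (∀ s, lam s j = 1) ∧
      ∀ᶠ s in 𝓝 (0 : ℂ), ∀ c, j - m ≤ c → i < c → c < j →
        v c ∈ intervalSpan v (c + 1) (G c) →
        v c + (s * lam s c) • w c ∈
          intervalSpan (fun e => v e + (s * lam s e) • w e) (c + 1) (G c) by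
    obtain ⟨lam, h1, h2, h3, h4⟩ := key (j - i).toNat
    refine ⟨lam, h1, h2, h3, h4.mono fun s hs c hc => hs c (by omega) hc⟩
  intro m
  induction m with
  | zero =>
    refine ⟨fun _ c => if c = j then 1 else 0, fun c => continuousAt_const, ?_, ?_, ?_⟩
    · intro s c hc
      exact if_neg hc.ne'
    · intro s
      exact if_pos rfl
    · exact Eventually.of_forall fun s c h1 h2 h3 => absurd h3 (by simpa using h1)
  | succ m ih =>
    obtain ⟨lam, h1, h2, h3, h4⟩ := ih
    set c₀ : ℤ := j - (m + 1 : ℕ) with hc₀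
    by_cases hcase : i < c₀ ∧ v c₀ ∈ intervalSpan v (c₀ + 1) (G c₀)
    swap
    · refine ⟨lam, h1, h2, h3, h4.mono fun s hs c hc hic hcj hm => ?_⟩
      by_cases hcc : c = c₀
      · subst hcc
        exact absurd ⟨hic, hm⟩ hcase
      · exact hs c (by omega) hic hcj hm
    obtain ⟨hic, hmem⟩ := hcase
    obtain ⟨y, hy⟩ := exists_sum_of_mem_intervalSpan hmem
    let π : ℂ → ℤ → ℂ := fun s d => ∏ e ∈ Finset.Ioc c₀ d, (1 + x e * (s * lam s e))⁻¹
    -- The coefficients are chosen for decreasing `c`. Replacing each `v d` in `v c₀ = ∑ y d • v d`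
    -- by its deformation adds `s λ_d w d ≡ s λ_d π_d w c₀`, so the relation persists exactly with
    -- this value of `λ_{c₀}`.
    let κ : ℂ → ℂ := fun s => ∑ d ∈ Finset.Icc (c₀ + 1) (G c₀), y d * (lam s d * π s d)
    have hcont : ∀ e, ContinuousAt (fun s => 1 + x e * (s * lam s e)) 0 := fun e =>
      continuousAt_const.add (continuousAt_const.mul (continuousAt_id.mul (h1 e)))
    have hκ : ContinuousAt κ 0 := by
      refine tendsto_finsetSum _ fun d _ => ?_
      refine continuousAt_const.mul ((h1 d).mul ?_)
      refine tendsto_finsetProd _ fun e _ => ?_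
      exact (hcont e).inv₀ (by simp)
    refine ⟨fun s => Function.update (lam s) c₀ (κ s), ?_, ?_, ?_, ?_⟩
    · intro c
      by_cases hcc : c = c₀
      · subst hcc
        simpa using hκ
      · simpa [Function.update_of_ne hcc] using h1 c
    · intro s c hc
      exact (Function.update_of_ne (by omega) _ _).trans (h2 s c hc)
    · intro s
      exact (Function.update_of_ne (by omega) _ _).trans (h3 s)
    · have hne : ∀ᶠ s in 𝓝 (0 : ℂ), ∀ e ∈ Finset.Icc (c₀ + 1) (G c₀),
          1 + x e * (s * lam s e) ≠ 0 := by
        rw [Filter.eventually_all_finset]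
        intro e _
        exact (hcont e).eventually_ne (by simp)
      filter_upwards [h4, hne] with s hs hs' c hc hic' hcj hm
      have hcongr : ∀ c, c₀ ≤ c →
          intervalSpan (fun e => v e + (s * Function.update (lam s) c₀ (κ s) e) • w e)
            (c + 1) (G c) = intervalSpan (fun e => v e + (s * lam s e) • w e) (c + 1) (G c) := by
        intro c hc
        refine intervalSpan_congr fun e he _ => ?_
        rw [Function.update_of_ne (by omega)]
      rw [hcongr c hc]
      by_cases hcc : c = c₀
      swap
      · rw [Function.update_of_ne hcc]
        exact hs c (by omega) hic' hcj hm
      subst hcc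
      rw [Function.update_self]
      set u : ℤ → E := fun e => v e + (s * lam s e) • w e with hu
      have hsum : v c₀ + (s * κ s) • w c₀ = ∑ d ∈ Finset.Icc (c₀ + 1) (G c₀),
          y d • (u d - (s * lam s d) • (w d - π s d • w c₀)) := by
        simp only [κ, Finset.mul_sum, Finset.sum_smul]
        nth_rewrite 1 [hy]
        rw [← Finset.sum_add_distrib]
        refine Finset.sum_congr rfl fun d _ => ?_
        simp only [hu]
        module
      rw [hsum]
      refine Submodule.sum_mem _ fun d hd => Submodule.smul_mem _ _ ?_
      rw [Finset.mem_Icc] at hd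
      refine Submodule.sub_mem _ (mem_intervalSpan u hd.1 hd.2) (Submodule.smul_mem _ _ ?_)
      refine intervalSpan_mono u le_rfl hd.2 ?_
      exact sub_prod_smul_mem_intervalSpan (μ := fun e => s * lam s e)
        (fun d hd => hw d (by omega)) (by omega)
        fun e he he' => hs' e (Finset.mem_Icc.2 ⟨by omega, by omega⟩)

end Deformation

end Positroid

namespace Positroid

open Filter Topology

/-! ### Deforming a periodic sequence along an elementary step. -/

section Periodic

variable {E : Type*} [NormedAddCommGroup E] [NormedSpace ℂ E]

/-- The representative of `m` modulo `n` in `(i, i + n]`. -/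
def windowRep (n : ℕ) (i m : ℤ) : ℤ := i + 1 + (m - i - 1) % n

theorem windowRep_of_mem {n : ℕ} {i m : ℤ} (h1 : i < m) (h2 : m ≤ i + n) :
    windowRep n i m = m := by
  unfold windowRep
  rw [Int.emod_eq_of_lt (by omega) (by omega)]
  ring

theorem windowRep_add (n : ℕ) (i m : ℤ) : windowRep n i (m + n) = windowRep n i m := by
  unfold windowRep
  have e : m + n - i - 1 = m - i - 1 + n := by ring
  rw [e, Int.add_emod_right]

theorem apply_windowRep {α : Type*} {n : ℕ} {v : ℤ → α} (hv : ∀ m, v (m + n) = v m) (i m : ℤ) :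
    v (windowRep n i m) = v m := by
  have h := Int.emod_add_mul_ediv (m - i - 1) n
  have : Function.Periodic v (n : ℤ) := hv
  have h2 := this.int_mul ((m - i - 1) / n) (windowRep n i m)
  rw [← h2]
  congr 1
  unfold windowRep
  rw [Int.cast_id, mul_comm]
  linarith

open Classical in
/-- The ranks of the deformation of a periodic sequence `v` with first return map `g`, where
`i < j ≤ g(j) < g(i) ≤ i + n`: exactly the intervals `[a, b]` with `i < a ≤ j` and
`g(j) ≤ b < g(i)` gain one dimension. -/
theorem exists_periodic_deformation [FiniteDimensional ℂ E] {n : ℕ} {v : ℤ → E} {g : ℤ → ℤ}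
    (hv : ∀ m, v (m + n) = v m) (hg : IsFirstReturn v g) (hgle : ∀ c, c ≤ g c) {i j : ℤ}
    (hij : i < j) (hji : g j < g i) (hi : g i ≤ i + n) :
    ∃ u : ℂ → ℤ → E, (∀ s m, u s (m + n) = u s m) ∧
      (∀ m, Tendsto (fun s => u s m) (𝓝[≠] 0) (𝓝 (v m))) ∧
      ∀ᶠ s in 𝓝[≠] (0 : ℂ), ∀ a b, i < a → a ≤ i + n → b < a + n →
        intervalRank (u s) a b =
          intervalRank v a b + if a ≤ j ∧ g j ≤ b ∧ b < g i then 1 else 0 := by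
  have hj := hgle j
  obtain ⟨z, hz⟩ := exists_sum_of_mem_intervalSpan ((hg i (g i) (by omega)).2 le_rfl)
  -- The truncations of the relation that first returns `v i`. Each `w c` lies both in the span of
  -- `v i, …, v c` and, for `i ≤ c ≤ g i`, in that of `v (c + 1), …, v (g i)`.
  let w : ℤ → E := fun c => v i - ∑ d ∈ Finset.Icc (i + 1) c, z d • v d
  have hw : ∀ c, i < c → w c = w (c - 1) + (-z c) • v c := by
    intro c hc
    have : Finset.Icc (i + 1) c = insert c (Finset.Icc (i + 1) (c - 1)) := by
      ext e; simp only [Finset.mem_Icc, Finset.mem_insert]; omega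
    simp only [w]
    rw [this, Finset.sum_insert (by simp)]
    module
  have hwL : ∀ c, i ≤ c → w c ∈ intervalSpan v i c := fun c hc => by
    refine Submodule.sub_mem _ (mem_intervalSpan v le_rfl hc) (Submodule.sum_mem _ fun d hd => ?_)
    rw [Finset.mem_Icc] at hd
    exact Submodule.smul_mem _ _ (mem_intervalSpan v (by omega) (by omega))
  have hwR : ∀ c, c ≤ g i → i ≤ c → w c ∈ intervalSpan v (c + 1) (g i) := by
    intro c hc
    induction c, hc using Int.leInductionDown with
    | base =>
      intro _
      have : w (g i) = 0 := by simp only [w]; rw [← hz, sub_self]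
      rw [this]
      exact Submodule.zero_mem _
    | pred c hc ih =>
      intro hic
      have h1 := ih (by omega)
      rw [hw c (by omega), neg_smul, ← sub_eq_add_neg] at h1
      have h2 := Submodule.add_mem _ (intervalSpan_mono v (a' := c) (by omega) le_rfl h1)
        (Submodule.smul_mem _ (z c) (mem_intervalSpan v (le_refl c) hc))
      rw [sub_add_cancel] at h2
      rwa [sub_add_cancel]
  -- Otherwise `v i` would already lie in the span of `v (i + 1), …, v b` with `b < g i`.
  have hwj : ∀ a b, i < a → j ≤ b → b < g i → w j ∉ intervalSpan v a b := by
    intro a b ha hb hbi h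
    have h1 : v i ∈ intervalSpan v (i + 1) b := by
      have h2 : ∑ d ∈ Finset.Icc (i + 1) j, z d • v d ∈ intervalSpan v (i + 1) b :=
        Submodule.sum_mem _ fun d hd => by
          rw [Finset.mem_Icc] at hd
          exact Submodule.smul_mem _ _ (mem_intervalSpan v hd.1 (by omega))
      have h3 := Submodule.add_mem _ (intervalSpan_mono v (a' := i + 1) ha le_rfl h) h2
      simpa only [w, sub_add_cancel] using h3
    have := (hg i b (by omega)).1 h1
    omega
  obtain ⟨lam, hlc, hl0, hl1, hlam⟩ := exists_deformation (v := v) (w := w) hw g (j := j)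
  let y : ℂ → ℤ → E := fun s c => v c + (s * lam s c) • w c
  let u : ℂ → ℤ → E := fun s m => y s (windowRep n i m)
  have hyv : ∀ s c, j < c → y s c = v c := fun s c hc => by simp [y, hl0 s c hc]
  have hu : ∀ s m, i < m → m ≤ i + n → u s m = y s m := fun s m h1 h2 => by
    simp only [u, windowRep_of_mem h1 h2]
  have hlim : ∀ m, Tendsto (fun s => u s m) (𝓝[≠] 0) (𝓝 (v m)) := by
    intro m
    rw [← apply_windowRep hv i m]
    have h1 : ContinuousAt (fun s => y s (windowRep n i m)) 0 :=
      continuousAt_const.add ((continuousAt_id.mul (hlc _)).smul continuousAt_const)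
    have h2 := h1.tendsto
    simp only [y, zero_mul, zero_smul, add_zero] at h2
    exact h2.mono_left nhdsWithin_le_nhds
  refine ⟨u, fun s m => by simp only [u, windowRep_add], hlim, ?_⟩
  have hsemi : ∀ᶠ s in 𝓝[≠] (0 : ℂ), ∀ a ∈ Finset.Icc (i + 1) (i + n),
      ∀ b ∈ Finset.Icc a (a + n), intervalRank v a b ≤ intervalRank (u s) a b := by
    rw [Filter.eventually_all_finset]
    intro a _
    rw [Filter.eventually_all_finset]
    intro b _
    exact eventually_intervalRank_le hlim a b
  filter_upwards [hsemi, hlam.filter_mono nhdsWithin_le_nhds, self_mem_nhdsWithin]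
    with s hs1 hs2 hs0 a b ha1 ha2 hb
  have hs0 : s ≠ 0 := hs0
  rcases lt_or_ge b a with hba | hab
  · rw [if_neg (by omega), intervalRank, intervalRank, intervalSpan_of_lt _ hba,
      intervalSpan_of_lt _ hba, finrank_bot]
  have hge := hs1 a (Finset.mem_Icc.2 ⟨ha1, ha2⟩) b (Finset.mem_Icc.2 ⟨hab, hb.le⟩)
  by_cases hbc : a ≤ j ∧ b < g i
  swap
  · -- every deformed vector stays in the original span
    rw [if_neg (by tauto), add_zero]
    refine le_antisymm (Submodule.finrank_mono (intervalSpan_le fun m h1 h2 => ?_)) hge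
    rcases le_or_gt m (i + n) with hm | hm
    · rw [hu s m (by omega) hm]
      rcases le_or_gt m j with hmj | hmj
      · refine Submodule.add_mem _ (mem_intervalSpan v h1 h2) (Submodule.smul_mem _ _ ?_)
        exact intervalSpan_mono v (by omega) (by omega) (hwR m (by omega) (by omega))
      · rw [hyv s m hmj]
        exact mem_intervalSpan v h1 h2
    -- Past the window `m` is the shift of `m - n`. There the perturbation lies in the span of `v i,
    -- …, v (m - n)`, whose shift starts at `i + n ≥ a`.
    · have e1 : m = m - n + n := by ring
      have e2 : u s m = y s (m - n) := by
        rw [← hu s (m - n) (by omega) (by omega)]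
        have h3 := windowRep_add n i (m - n)
        rw [sub_add_cancel] at h3
        simp only [u, h3]
      rw [e2]
      refine Submodule.add_mem _ ?_ (Submodule.smul_mem _ _ ?_)
      · rw [← hv, sub_add_cancel]
        exact mem_intervalSpan v h1 h2
      · have h3 := hwL (m - n) (by omega)
        rw [← intervalSpan_add_mul hv _ _ 1, one_mul, sub_add_cancel] at h3
        exact intervalSpan_mono v (by omega) h2 h3
  obtain ⟨haj, hbi⟩ := hbc
  have huy : ∀ c, i < c → intervalSpan (u s) c b = intervalSpan (y s) c b := fun c hc =>
    intervalSpan_congr fun m h1 h2 => hu s m (by omega) (by omega)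
  by_cases hbj : g j ≤ b
  · -- the span gains the vector `w j`
    rw [if_pos ⟨haj, hbj, hbi⟩]
    have hsup : intervalSpan (y s) a b = Submodule.span ℂ (insert (w j) (v '' Set.Icc a b)) := by
      apply le_antisymm
      · refine intervalSpan_le fun m h1 h2 => ?_
        have hvm : ∀ d, a ≤ d → d ≤ b →
            v d ∈ Submodule.span ℂ (insert (w j) (v '' Set.Icc a b)) := fun d h1 h2 =>
          Submodule.subset_span (Or.inr ⟨d, ⟨h1, h2⟩, rfl⟩)
        rcases le_or_gt m j with hmj | hmj
        swap
        · rw [hyv s m hmj]; exact hvm m h1 h2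
        refine Submodule.add_mem _ (hvm m h1 h2) (Submodule.smul_mem _ _ ?_)
        have ham := h1
        clear h1 h2
        suffices h : ∀ m, m ≤ j → a ≤ m →
            w m ∈ Submodule.span ℂ (insert (w j) (v '' Set.Icc a b)) from h m hmj ham
        intro m hm
        induction m, hm using Int.leInductionDown with
        | base => intro _; exact Submodule.subset_span (Or.inl rfl)
        | pred m hm ih =>
          intro ham
          have h1 := ih (by omega)
          rw [hw m (by omega), neg_smul, ← sub_eq_add_neg] at h1
          have h2 := Submodule.add_mem _ h1
            (Submodule.smul_mem _ (z m) (hvm m (by omega) (by omega)))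
          rwa [sub_add_cancel] at h2
      · -- descending from `j`, the deformed span contains every `w c` and `v c`
        have key : ∀ c, c ≤ j → i < c → w c ∈ intervalSpan (y s) c b ∧
            intervalSpan v c b ≤ intervalSpan (y s) c b := by
          have hstep : ∀ c, i < c → c ≤ b → w c ∈ intervalSpan (y s) c b →
              intervalSpan v (c + 1) b ≤ intervalSpan (y s) (c + 1) b →
              intervalSpan v c b ≤ intervalSpan (y s) c b := by
            intro c hc hcb h1 h2
            rw [intervalSpan_left v hcb, Submodule.span_le]
            rintro x (rfl | hx)
            · have h3 := Submodule.sub_mem _ (mem_intervalSpan (y s) (le_refl c) hcb)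
                (Submodule.smul_mem _ (s * lam s c) h1)
              simp only [y, add_sub_cancel_right] at h3
              exact h3
            · exact intervalSpan_mono (y s) (by omega) le_rfl (h2 (Submodule.subset_span hx))
          intro c hc
          induction c, hc using Int.leInductionDown with
          | base =>
            intro _
            have h1 : intervalSpan v (j + 1) b = intervalSpan (y s) (j + 1) b :=
              intervalSpan_congr fun m h1 _ => (hyv s m (by omega)).symm
            -- The vectors beyond `j` are not deformed, and `g j ≤ b`, so `v j` lies in the deformed
            -- span. Subtracting it from the deformed `j`-th vector leaves `s • w j`, and `s ≠ 0`.
            have h2 : v j ∈ intervalSpan (y s) j b := by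
              have h3 := (hg j b (by omega)).2 hbj
              rw [h1] at h3
              exact intervalSpan_mono (y s) (by omega) le_rfl h3
            have h3 : w j ∈ intervalSpan (y s) j b := by
              have h4 := Submodule.sub_mem _ (mem_intervalSpan (y s) (le_refl j) (by omega)) h2
              simp only [y, add_sub_cancel_left, hl1, mul_one] at h4
              exact (Submodule.smul_mem_iff _ hs0).1 h4
            exact ⟨h3, hstep j hij (by omega) h3 h1.le⟩
          | pred c hc ih =>
            intro hic
            obtain ⟨h1, h2⟩ := ih (by omega)
            have h3 : w (c - 1) ∈ intervalSpan (y s) (c - 1) b := by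
              rw [hw c (by omega), neg_smul, ← sub_eq_add_neg] at h1
              have h4 := Submodule.add_mem _ h1 (Submodule.smul_mem _ (z c)
                (h2 (mem_intervalSpan v (le_refl c) (by omega))))
              rw [sub_add_cancel] at h4
              exact intervalSpan_mono (y s) (by omega) le_rfl h4
            refine ⟨h3, hstep (c - 1) hic (by omega) h3 ?_⟩
            rw [sub_add_cancel]
            exact h2
        rw [Submodule.span_le]
        rintro x (rfl | hx)
        · exact intervalSpan_mono (y s) haj le_rfl (key j le_rfl hij).1
        · exact (key a haj ha1).2 (Submodule.subset_span hx)
    unfold intervalRank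
    rw [huy a ha1, hsup, finrank_span_insert_of_notMem (hwj a b ha1 (by omega) hbi)]
    rfl
  · -- the dependencies within `[a, b]` persist
    rw [if_neg (by tauto), add_zero]
    refine le_antisymm ?_ hge
    clear hge
    suffices h : ∀ c, c ≤ j + 1 → i < c → intervalRank (y s) c b ≤ intervalRank v c b by
      rw [intervalRank, huy a ha1]
      exact h a (by omega) ha1
    intro c hc
    induction c, hc using Int.leInductionDown with
    | base =>
      intro _
      rw [intervalRank, intervalRank,
        intervalSpan_congr (w := v) fun m h1 _ => hyv s m (by omega)]
    | pred c hc ih =>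
      intro hic
      have h1 := ih (by omega)
      rcases lt_or_ge b (c - 1) with hcb | hcb
      · rw [intervalRank, intervalSpan_of_lt _ hcb, finrank_bot]
        exact Nat.zero_le _
      rw [hg.intervalRank_succ hcb, intervalRank_succ (y s) hcb, sub_add_cancel]
      by_cases hgc : b < g (c - 1)
      · rw [if_pos hgc]
        split_ifs <;> omega
      -- Every relation within `[c - 1, b]` survives except possibly that of `v j`, which is not
      -- available because `b < g j`.
      · have h2 : c - 1 ≠ j := by rintro rfl; omega
        have h3 := hs2 (c - 1) hic (by omega) ((hg (c - 1) _ (hgle _)).2 le_rfl)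
        have h4 : y s (c - 1) ∈ intervalSpan (y s) c b := by
          have := intervalSpan_mono (y s) (le_refl (c - 1 + 1)) (not_lt.1 hgc) h3
          rwa [sub_add_cancel] at this
        rw [if_pos h4, if_neg hgc]
        omega

/-- For an elementary step `(i, j)` from `f` to `g = f t`, every periodic sequence with first
return map `g` is a limit of periodic sequences with first return map `f`. -/
theorem exists_isFirstReturn_tendsto [FiniteDimensional ℂ E] {n : ℕ} {v : ℤ → E} {f g : ℤ → ℤ}
    (hv : ∀ m, v (m + n) = v m) (hg : IsFirstReturn v g) (hgle : ∀ c, c ≤ g c) {i j : ℤ}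
    (hij : i < j) (hji : g j < g i) (hi : g i ≤ i + n) (hle : ∀ c, f c ≤ c + n)
    (hfn : ∀ c r : ℤ, f (c + r * n) = f c + r * n)
    (hfi : f i = g j) (hfj : f j = g i) (hgn : g (i + n) = g i + n)
    (hfg : ∀ c, i < c → c < i + n → c ≠ j → f c = g c) :
    ∃ u : ℂ → ℤ → E, (∀ s m, u s (m + n) = u s m) ∧
      (∀ m, Tendsto (fun s => u s m) (𝓝[≠] 0) (𝓝 (v m))) ∧
      ∀ᶠ s in 𝓝[≠] (0 : ℂ), IsFirstReturn (u s) f := by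
  classical
  obtain ⟨u, hu, hlim, hrank⟩ := exists_periodic_deformation hv hg hgle hij hji hi
  refine ⟨u, hu, hlim, hrank.mono fun s hs => ?_⟩
  have hj := hgle j
  have hn : 0 < n := by omega
  suffices h : ∀ a b, i < a → a ≤ i + n → a ≤ b → (u s a ∈ intervalSpan (u s) (a + 1) b ↔ f a ≤ b) by
    intro a b hab
    obtain ⟨c, r, h1, h2, h3⟩ := exists_mem_Icc_add_mul hn (a - i)
    have ha : a = (c + i) + r * n := by linarith
    have hper : Function.Periodic (u s) (n : ℤ) := hu s
    have h4 := hper.int_mul r (c + i)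
    rw [Int.cast_id, ← ha] at h4
    have h5 := h (c + i) (b - r * n) (by omega) (by omega) (by linarith)
    rw [h4, ha, hfn, ← sub_add_cancel b (r * n)]
    have e : c + i + r * n + 1 = c + i + 1 + r * (n : ℤ) := by ring
    rw [e, intervalSpan_add_mul (hu s), h5]
    constructor <;> intro <;> linarith
  intro a b ha1 ha2 hab
  rcases le_or_gt (a + n) b with hb | hb
  · refine iff_of_true ?_ ((hle a).trans hb)
    rw [← hu s a]
    exact mem_intervalSpan _ (by omega) hb
  have e1 := intervalRank_succ (u s) hab
  have e2 := hg.intervalRank_succ hab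
  have e3 := hs a b ha1 ha2 hb
  -- The change in the rank increments sits at the two vertical sides of the rectangle. Its left
  -- side is met at `a = i + n`, whose right neighbour leaves the window and is shifted back to `i +
  -- 1`; the other side is at `a = j`.
  by_cases hain : a = i + n
  · have e4 := hs (i + 1) (b - n) (by omega) (by omega) (by omega)
    have e5 : ∀ x : ℤ → E, (∀ m, x (m + n) = x m) →
        intervalRank x (a + 1) b = intervalRank x (i + 1) (b - n) := by
      intro x hx
      have := intervalSpan_add_mul hx (i + 1) (b - n) 1
      rw [one_mul, sub_add_cancel] at this
      have e : i + n + 1 = i + 1 + (n : ℤ) := by ring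
      rw [intervalRank, intervalRank, ← this, hain, e]
    rw [e5 _ (hu s)] at e1
    rw [e5 _ hv] at e2
    have hfa : f a = g j + n := by
      have := hfn i 1
      rw [one_mul] at this
      rw [hain, this, hfi]
    have hga : g a = g i + n := by rw [hain, hgn]
    split_ifs at e1 e2 e3 e4 with hm <;> simp only [hm, true_iff, false_iff] <;> omega
  · have e4 := hs (a + 1) b (by omega) (by omega) (by omega)
    by_cases haj : a = j
    · subst haj
      split_ifs at e1 e2 e3 e4 with hm <;> simp only [hm, true_iff, false_iff] <;> omega
    · have hfa := hfg a ha1 (by omega) haj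
      split_ifs at e1 e2 e3 e4 with hm <;> simp only [hm, true_iff, false_iff] <;> omega

end Periodic

end Positroid

namespace Positroid

open Filter Topology

/-! ### Zariski closures -/

section Zariski

variable {k n : ℕ}

theorem isClosed_iff_zeroLocus {Z : Set (Gr k n)} :
    IsClosed Z ↔ ∃ T ⊆ homogeneousPolys k n, Z = zeroLocus T := by
  rw [← isOpen_compl_iff]
  change Zᶜᶜ ∈ {Z | ∃ T ⊆ homogeneousPolys k n, Z = zeroLocus T} ↔ _
  rw [compl_compl]
  rfl

theorem eval_mul_of_isHomogeneous {σ : Type*} {p : MvPolynomial σ ℂ} {d : ℕ}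
    (hp : p.IsHomogeneous d) (c : ℂ) (x : σ → ℂ) :
    MvPolynomial.eval (fun i => c * x i) p = c ^ d * MvPolynomial.eval x p := by
  rw [MvPolynomial.eval_eq, MvPolynomial.eval_eq, Finset.mul_sum]
  refine Finset.sum_congr rfl fun m hm => ?_
  have hd := hp (MvPolynomial.mem_support_iff.1 hm)
  have : ∏ i ∈ m.support, (c * x i) ^ m i = c ^ d * ∏ i ∈ m.support, x i ^ m i := by
    rw [← hd, Finsupp.weight_apply, Finsupp.sum, ← Finset.prod_pow_eq_pow_sum,
      ← Finset.prod_mul_distrib]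
    simp [mul_pow]
  rw [this]
  ring

/-- The maximal minors of a matrix with row space `V` are proportional to the Plücker
coordinates of `V`. -/
theorem exists_det_submatrix_eq {V : Gr k n} {A : Matrix (Fin k) (Fin n) ℂ}
    (hA : Submodule.span ℂ (Set.range A) = V.1) :
    ∃ c : ℂ, ∀ I : Fin k ↪o Fin n, (A.submatrix id I).det = c * pluckerCoord V I := by
  let b := Module.finBasisOfFinrankEq ℂ V.1 V.2
  have hmem : ∀ r, A r ∈ V.1 := fun r => hA ▸ Submodule.subset_span ⟨r, rfl⟩
  let G : Matrix (Fin k) (Fin k) ℂ := Matrix.of fun r q => b.repr ⟨A r, hmem r⟩ q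
  have hG : A = G * basisMatrix V := by
    ext r c
    have h := congrArg (fun x : V.1 => (x : Fin n → ℂ) c) (b.sum_repr ⟨A r, hmem r⟩)
    simp only [Submodule.coe_sum, Submodule.coe_smul, Finset.sum_apply, Pi.smul_apply,
      smul_eq_mul] at h
    rw [Matrix.mul_apply, ← h]
    rfl
  refine ⟨G.det, fun I => ?_⟩
  rw [pluckerCoord, ← Matrix.det_mul]
  conv_lhs => rw [hG]
  rfl

/-- A homogeneous polynomial vanishing on `S` vanishes on the minors of each `A s`, whichever basis
these use, and by continuity on those of the limit. This carries Euclidean limits into Zariski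
closures. -/
theorem mem_closure_of_tendsto_basisMatrix {S : Set (Gr k n)} {V : Gr k n} {ι : Type*}
    {l : Filter ι} [l.NeBot] {A : ι → Matrix (Fin k) (Fin n) ℂ}
    (hA : ∀ r c, Tendsto (fun s => A s r c) l (𝓝 (basisMatrix V r c)))
    (hS : ∀ᶠ s in l, ∃ W ∈ S, Submodule.span ℂ (Set.range (A s)) = W.1) : V ∈ closure S := by
  rw [closure, Set.mem_sInter]
  rintro Z ⟨hZ, hSZ⟩
  obtain ⟨T, hT, rfl⟩ := isClosed_iff_zeroLocus.1 hZ
  intro p hp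
  obtain ⟨d, hd⟩ := hT hp
  have hlim : Tendsto (fun s => MvPolynomial.eval (fun I : Fin k ↪o Fin n =>
      ((A s).submatrix id I).det) p) l (𝓝 (MvPolynomial.eval (pluckerCoord V) p)) := by
    refine ((MvPolynomial.continuous_eval p).tendsto _).comp (tendsto_pi_nhds.2 fun I => ?_)
    have hm : Tendsto (fun s => (A s).submatrix id I) l (𝓝 ((basisMatrix V).submatrix id I)) :=
      tendsto_pi_nhds.2 fun r => tendsto_pi_nhds.2 fun c => hA r (I c)
    exact ((continuous_id.matrix_det).tendsto ((basisMatrix V).submatrix id I)).comp hm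
  refine tendsto_nhds_unique hlim (tendsto_const_nhds.congr' ?_)
  filter_upwards [hS] with s ⟨W, hW, hAW⟩
  obtain ⟨c, hc⟩ := exists_det_submatrix_eq hAW
  rw [funext hc, eval_mul_of_isHomogeneous hd, hSZ hW p hp, mul_zero]

theorem pluckerCoord_ne_zero_iff (V : Gr k n) (I : Fin k ↪o Fin n) :
    pluckerCoord V I ≠ 0 ↔ LinearIndependent ℂ fun r => (basisMatrix V).transpose (I r) := by
  rw [pluckerCoord, ← isUnit_iff_ne_zero, ← Matrix.isUnit_iff_isUnit_det,
    ← Matrix.linearIndependent_cols_iff_isUnit]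
  rfl

/-- An upper bound on the rank of a coordinate projection is a closed condition: it amounts to the
vanishing of the Plücker coordinates `I` with `#(I ∩ S) > m`. -/
theorem isClosed_setOf_projDim_le (S : Set (Fin n)) (m : ℕ) :
    IsClosed {V : Gr k n | projDim S V ≤ m} := by
  classical
  rw [isClosed_iff_zeroLocus]
  refine ⟨{p | ∃ I : Fin k ↪o Fin n, m < (Finset.univ.filter fun r => I r ∈ S).card ∧
    p = MvPolynomial.X I}, ?_, ?_⟩
  · rintro _ ⟨I, -, rfl⟩
    exact ⟨1, MvPolynomial.isHomogeneous_X _ _⟩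
  ext V
  have hV := span_range_basisMatrix V
  rw [Set.mem_ofPred_eq, projDim_eq_finrank_span hV]
  constructor
  · rintro h _ ⟨I, hI, rfl⟩
    rw [MvPolynomial.eval_X]
    by_contra hne
    have hli := (pluckerCoord_ne_zero_iff V I).1 hne
    have hli' := hli.comp (fun r : {r // I r ∈ S} => (r : Fin k)) Subtype.val_injective
    have h1 := finrank_span_eq_card hli'
    rw [Fintype.card_subtype] at h1
    have h2 : Module.finrank ℂ (Submodule.span ℂ (Set.range
        ((fun r => (basisMatrix V).transpose (I r)) ∘ fun r : {r // I r ∈ S} => (r : Fin k)))) ≤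
        Module.finrank ℂ (Submodule.span ℂ ((basisMatrix V).transpose '' S)) := by
      apply Submodule.finrank_mono
      apply Submodule.span_mono
      rintro _ ⟨⟨r, hr⟩, rfl⟩
      exact ⟨I r, hr, rfl⟩
    omega
  · intro h
    by_contra hcon
    rw [not_le] at hcon
    -- A basis `B` of the span of the columns in `S` has more than `m` elements. Extended to a basis
    -- `C` of the column space, it gives a nonvanishing Plücker coordinate with more than `m`
    -- indices in `S`.
    obtain ⟨B, hBS, -, hBspan, hBli⟩ := exists_linearIndepOn_extension
      (linearIndepOn_empty ℂ (basisMatrix V).transpose) (Set.empty_subset S)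
    obtain ⟨C, -, hBC, hCspan, hCli⟩ := exists_linearIndepOn_extension hBli (Set.subset_univ B)
    have hcardB : m < Fintype.card B := by
      refine hcon.trans_le ?_
      rw [← finrank_span_eq_card hBli]
      apply Submodule.finrank_mono
      rw [Submodule.span_le]
      rwa [Set.image_eq_range (basisMatrix V).transpose B] at hBspan
    have hcardC : Fintype.card C = k := by
      refine (finrank_span_eq_card hCli).symm.trans (Eq.trans ?_ V.2)
      rw [← hV]
      have h1 : Submodule.span ℂ (Set.range fun c : C => (basisMatrix V).transpose c) =
          Submodule.span ℂ (Set.range (basisMatrix V).col) := by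
        apply le_antisymm
        · apply Submodule.span_mono
          rintro _ ⟨c, rfl⟩
          exact ⟨c, rfl⟩
        · rw [Submodule.span_le]
          rw [Set.image_eq_range (basisMatrix V).transpose C] at hCspan
          rintro _ ⟨c, rfl⟩
          exact hCspan ⟨c, trivial, rfl⟩
      rw [h1, ← Matrix.rank_eq_finrank_span_cols, Matrix.rank_eq_finrank_span_row]
      rfl
    have hC' : C.toFinset.card = k := by rw [Set.toFinset_card, hcardC]
    let I : Fin k ↪o Fin n := C.toFinset.orderEmbOfFin hC'
    have hIC : ∀ r, I r ∈ C := fun r => by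
      have := Finset.orderEmbOfFin_mem C.toFinset hC' r
      rwa [Set.mem_toFinset] at this
    have hne : pluckerCoord V I ≠ 0 := by
      rw [pluckerCoord_ne_zero_iff]
      exact hCli.comp (fun r => (⟨I r, hIC r⟩ : C)) fun r q h =>
        I.injective (Subtype.mk.inj h)
    refine hne ?_
    have h2 := h (MvPolynomial.X I) ⟨I, hcardB.trans_le ?_, rfl⟩
    · rwa [MvPolynomial.eval_X] at h2
    rw [← Fintype.card_subtype]
    refine Fintype.card_le_of_injective (fun c : B =>
      (⟨(C.toFinset.orderIsoOfFin hC').symm ⟨c, Set.mem_toFinset.2 (hBC c.2)⟩, ?_⟩ :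
        {r // I r ∈ S})) ?_
    · have : I ((C.toFinset.orderIsoOfFin hC').symm ⟨c, Set.mem_toFinset.2 (hBC c.2)⟩) = c := by
        simp only [I, ← Finset.coe_orderIsoOfFin_apply, OrderIso.apply_symm_apply]
      rw [this]
      exact hBS c.2
    · intro c d hcd
      have := (C.toFinset.orderIsoOfFin hC').symm.injective (congrArg Subtype.val hcd)
      exact Subtype.ext (Subtype.mk.inj this)

end Zariski

end Positroid

namespace Positroid

open Filter Topology

/-! ### Open positroid varieties: closures and nonemptiness -/

section Varieties

variable {k n : ℕ}

theorem exists_gr_of_intervalRank_eq (hn : 0 < n) {A : Matrix (Fin k) (Fin n) ℂ}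
    (hA : intervalRank (columns hn A) 1 n = k) :
    ∃ W : Gr k n, Submodule.span ℂ (Set.range A) = W.1 := by
  refine ⟨⟨Submodule.span ℂ (Set.range A), ?_⟩, rfl⟩
  have h1 : columns hn A '' Set.Icc 1 n = Set.range A.col := by
    ext x
    constructor
    · rintro ⟨m, -, rfl⟩
      exact ⟨colIndex hn m, rfl⟩
    · rintro ⟨c, rfl⟩
      refine ⟨(c : ℕ) + 1, ⟨by omega, by have := c.2; omega⟩, ?_⟩
      funext r
      simp only [columns, colIndex_natCast_add_one]
      rfl
  rw [intervalRank, intervalSpan, h1, ← Matrix.rank_eq_finrank_span_cols,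
    Matrix.rank_eq_finrank_span_row] at hA
  exact hA

/-- The deformed columns form matrices tending to `basisMatrix V`. By semicontinuity they have full
rank for small `s ≠ 0`, so their row spaces lie in `Gr(k,n)`, in the open variety of `f`. -/
theorem Bound.StepTo.openPositroidVariety_subset_closure (hn : 0 < n) {f g : Bound k n} {i j : ℤ}
    (h : f.StepTo g i j) : openPositroidVariety g ⊆ closure (openPositroidVariety f) := by
  intro V hV
  have hAV := span_range_basisMatrix V
  have hg := (mem_openPositroidVariety_iff hn hAV g).1 hV
  obtain ⟨t, ht, hgt⟩ := h.exists_swap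
  have hgi : g.1 i = f.1 j := by rw [hgt, Equiv.Perm.mul_apply, ht.left]
  have hgj : g.1 j = f.1 i := by rw [hgt, Equiv.Perm.mul_apply, ht.right]
  have hlt := h.lt
  have hle := h.le
  have happ := h.apply_lt
  have hapn := h.apply_le
  have hncong : ∀ c d : ℤ, c < d → d < c + n → ¬ c ≡ d [ZMOD n] := by
    intro c d h1 h2 h3
    have := Int.le_of_dvd (by omega) (Int.modEq_iff_dvd.1 h3)
    omega
  obtain ⟨u, hu, hlim, hfr⟩ := exists_isFirstReturn_tendsto (f := f.1) (columns_add hn _) hg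
    g.le_apply hlt (by omega) (by omega) f.apply_le f.isAffine.apply_add_mul hgj.symm hgi.symm
    (g.isAffine i) (fun c h1 h2 h3 => by
      rw [hgt, Equiv.Perm.mul_apply, ht.apply_of_not]
      · exact fun hc => hncong i c h1 h2 hc.symm
      · intro hc
        rcases lt_or_gt_of_ne h3 with h4 | h4
        · exact hncong c j h4 (by omega) hc
        · exact hncong j c h4 (by omega) hc.symm)
  refine mem_closure_of_tendsto_basisMatrix (l := 𝓝[≠] (0 : ℂ))
    (A := fun s => Matrix.of fun r (c : Fin n) => u s ((c : ℕ) + 1) r) ?_ ?_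
  · intro r c
    have h1 := ((continuous_apply r).tendsto _).comp (hlim ((c : ℕ) + 1))
    simp only [columns, colIndex_natCast_add_one] at h1
    exact h1
  · have hk : intervalRank (columns hn (basisMatrix V)) 1 n = k := by
      have h1 := cyclicRank_of_le hn hAV (a := 1) (b := n) (by omega)
      rw [cyclicRank_of_full hn V (by omega)] at h1
      exact_mod_cast h1.symm
    filter_upwards [hfr, eventually_intervalRank_le hlim 1 n] with s hs1 hs2
    have hcol := columns_of_periodic hn (hu s)
    have hfull : intervalRank (u s) 1 n = k := by
      refine le_antisymm ?_ (hk.symm.le.trans hs2)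
      refine (Submodule.finrank_le _).trans ?_
      simp
    obtain ⟨W, hW⟩ := exists_gr_of_intervalRank_eq hn (by rw [hcol]; exact hfull)
    refine ⟨W, (mem_openPositroidVariety_iff hn hW f).2 ?_, hW⟩
    rw [hcol]
    exact hs1

/-- If `f(c) ∈ {c, c + n}` for all `c`, then the open positroid variety of `f` contains a
coordinate subspace. -/
theorem openPositroidVariety_nonempty_of_fixed (hn : 0 < n) (f : Bound k n)
    (hf : ∀ c, f.1 c = c ∨ f.1 c = c + n) : (openPositroidVariety f).Nonempty := by
  classical
  let K : Finset (Fin n) := Finset.univ.filter fun c => f.1 ((c : ℕ) + 1) = (c : ℕ) + 1 + n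
  have hKmem : ∀ c, c ∈ K ↔ f.1 ((c : ℕ) + 1) = (c : ℕ) + 1 + n := fun c => by simp [K]
  have hK : K.card = k := by
    have h1 := f.2.2.2
    have h2 : ∑ i ∈ Finset.Icc (1 : ℤ) n, (f.1 i - i) =
        ∑ c : Fin n, (f.1 ((c : ℕ) + 1) - ((c : ℕ) + 1)) := by
      symm
      refine Finset.sum_bij (fun c _ => ((c : ℕ) : ℤ) + 1) ?_ ?_ ?_ ?_
      · intro c _
        have := c.2
        rw [Finset.mem_Icc]
        omega
      · intro c _ d _ h
        exact Fin.ext (by omega)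
      · intro i hi
        rw [Finset.mem_Icc] at hi
        exact ⟨⟨(i - 1).toNat, by omega⟩, Finset.mem_univ _, by simp only; omega⟩
      · intro c _
        rfl
    have h3 : ∑ c : Fin n, (f.1 ((c : ℕ) + 1) - ((c : ℕ) + 1)) = n * (K.card : ℤ) := by
      rw [Finset.card_filter, Nat.cast_sum, Finset.mul_sum]
      refine Finset.sum_congr rfl fun c _ => ?_
      rcases hf ((c : ℕ) + 1) with h | h
      · have : ¬ f.1 ((c : ℕ) + 1) = (c : ℕ) + 1 + n := by omega
        rw [if_neg this, h]; simp
      · rw [if_pos h, h]; simp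
    have hn' : (n : ℤ) ≠ 0 := by exact_mod_cast hn.ne'
    have h4 : (n : ℤ) * (K.card : ℤ) = n * k := by rw [← h3, ← h2]; exact h1
    exact_mod_cast mul_left_cancel₀ hn' h4
  let e : Fin k ≃ K := (Fintype.equivFinOfCardEq (by rw [Fintype.card_coe, hK])).symm
  let A : Matrix (Fin k) (Fin n) ℂ := Matrix.of fun r c => if (e r : Fin n) = c then 1 else 0
  have hli : LinearIndependent ℂ A.row := by
    have h1 := (Pi.basisFun ℂ (Fin n)).linearIndependent.comp (fun r => (e r : Fin n))
      (Subtype.val_injective.comp e.injective)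
    convert h1 using 1
    funext r c
    simp [A, Matrix.row, Pi.single_apply, eq_comm]
  let W : Gr k n := ⟨Submodule.span ℂ (Set.range A), by
    exact (finrank_span_eq_card hli).trans (Fintype.card_fin k)⟩
  refine ⟨W, (mem_openPositroidVariety_iff hn (A := A) rfl f).2 fun a b hab => ?_⟩
  obtain ⟨q, hq⟩ := exists_eq_add_mul_of_modEq (colIndex_modEq hn a)
  have hfa := f.isAffine.apply_add_mul ((colIndex hn a : ℕ) + 1) q
  rw [← hq] at hfa
  by_cases hc : colIndex hn a ∈ K
  · have hc' : f.1 ((colIndex hn a : ℕ) + 1) = (colIndex hn a : ℕ) + 1 + n :=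
      (hKmem _).1 hc
    have hfa' : f.1 a = a + n := by rw [hfa, hc']; omega
    rw [hfa']
    constructor
    · intro h
      by_contra hb
      have hle : intervalSpan (columns hn A) (a + 1) b ≤
          LinearMap.ker (LinearMap.proj (R := ℂ) (φ := fun _ : Fin k => ℂ)
            (e.symm ⟨colIndex hn a, hc⟩)) := by
        refine intervalSpan_le fun d h1 h2 => ?_
        rw [LinearMap.mem_ker, LinearMap.proj_apply]
        simp only [columns, A, Matrix.of_apply, Equiv.apply_symm_apply]
        refine if_neg fun h3 => ?_
        have h4 := (colIndex_eq_iff hn d (colIndex hn a)).1 h3.symm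
        have h5 := Int.le_of_dvd (by omega)
          (Int.modEq_iff_dvd.1 ((colIndex_modEq hn a).trans h4.symm))
        omega
      have h1 := hle h
      rw [LinearMap.mem_ker, LinearMap.proj_apply] at h1
      simp [columns, A] at h1
    · intro h
      rw [← columns_add]
      exact mem_intervalSpan _ (by omega) h
  · have hfa' : f.1 a = a := by
      rcases hf ((colIndex hn a : ℕ) + 1) with h | h
      · rw [hfa, h]; omega
      · exact absurd ((hKmem _).2 h) hc
    have h0 : columns hn A a = 0 := by
      funext r
      simp only [columns, A, Matrix.of_apply, Pi.zero_apply]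
      exact if_neg fun h => hc (by rw [← h]; exact (e r).2)
    rw [h0, hfa']
    exact iff_of_true (Submodule.zero_mem _) hab

/-- If a step leads from `f` to `g`, a nonempty variety for `g` lies in the closure of that of `f`,
which therefore is nonempty. Permutations admitting no step are those with `f c ∈ {c, c + n}`
throughout. -/
theorem openPositroidVariety_nonempty (hn : 0 < n) (f : Bound k n) :
    (openPositroidVariety f).Nonempty := by
  induction f using Bound.step_induction hn with
  | h f ih =>
    by_cases hf : ∀ c, f.1 c = c ∨ f.1 c = c + n
    · exact openPositroidVariety_nonempty_of_fixed hn f hf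
    · push Not at hf
      obtain ⟨c, h1, h2⟩ := hf
      obtain ⟨g, i, j, hg⟩ := f.exists_stepTo_of_ne hn h1 h2
      exact closure_nonempty_iff.1
        ((ih g i j hg).mono (hg.openPositroidVariety_subset_closure hn))

theorem isClosed_setOf_cyclicRank_le (a b z : ℤ) : IsClosed {V : Gr k n | cyclicRank V a b ≤ z} := by
  by_cases h : b < a
  · simp only [cyclicRank, if_pos h]
    by_cases hz : b - a + 1 ≤ z <;> simp [hz]
  · simp only [cyclicRank, if_neg h]
    by_cases hz : 0 ≤ z
    · lift z to ℕ using hz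
      simp only [Nat.cast_le]
      exact isClosed_setOf_projDim_le _ _
    · convert isClosed_empty
      ext V
      simp only [Set.mem_ofPred_eq, Set.mem_empty_iff_false, iff_false]
      omega

theorem eq_of_mem_openPositroidVariety (hn : 0 < n) {f g : Bound k n} {V : Gr k n}
    (hf : V ∈ openPositroidVariety f) (hg : V ∈ openPositroidVariety g) : f = g :=
  Bound.ext_of_rankMatrix hn fun a b => (hf a b).symm.trans (hg a b)

/-- The positroid variety of `f` is defined by the upper bounds on the cyclic ranks. -/
theorem positroidVariety_eq_setOf_cyclicRank_le (hn : 0 < n) (f : Bound k n) :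
    positroidVariety f = {V | ∀ a b, cyclicRank V a b ≤ rankMatrix f a b} := by
  apply Set.Subset.antisymm
  · refine closure_minimal (fun V hV a b => (hV a b).le) ?_
    have : {V : Gr k n | ∀ a b, cyclicRank V a b ≤ rankMatrix f a b} =
        ⋂ a, ⋂ b, {V : Gr k n | cyclicRank V a b ≤ rankMatrix f a b} := by
      ext V; simp
    rw [this]
    exact isClosed_iInter fun a => isClosed_iInter fun b => isClosed_setOf_cyclicRank_le a b _
  · intro V hV
    obtain ⟨g, hg⟩ := exists_mem_openPositroidVariety hn V
    have hchain := Bound.reflTransGen_of_rankMatrix_le hn f g fun a b => hg a b ▸ hV a b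
    have hsub : openPositroidVariety g ⊆ closure (openPositroidVariety f) := by
      clear hg hV
      induction hchain with
      | refl => exact subset_closure
      | tail _ hstep ih =>
        obtain ⟨i, j, hs⟩ := hstep
        exact (hs.openPositroidVariety_subset_closure hn).trans
          (closure_minimal ih isClosed_closure)
    exact hsub hg

theorem positroidVariety_eq_iUnion (hn : 0 < n) (f : Bound k n) :
    positroidVariety f =
      ⋃ f' ∈ {f' : Bound k n | BruhatLE n f.1 f'.1}, openPositroidVariety f' := by
  rw [positroidVariety_eq_setOf_cyclicRank_le hn]
  ext V
  simp only [Set.mem_iUnion, Set.mem_ofPred_eq, Bound.bruhatLE_iff hn]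
  constructor
  · intro h
    obtain ⟨g, hg⟩ := exists_mem_openPositroidVariety hn V
    exact ⟨g, fun a b => hg a b ▸ h a b, hg⟩
  · rintro ⟨g, h, hg⟩ a b
    exact (hg a b).le.trans (h a b)

/-- The open variety is `Π_f` with the finitely many smaller positroid varieties removed. -/
theorem isLocallyClosed_openPositroidVariety (hn : 0 < n) (f : Bound k n) :
    IsLocallyClosed (openPositroidVariety f) := by
  have hfin := Bound.finite (k := k) hn
  have hclosed : ∀ g : Bound k n, IsClosed (positroidVariety g) := fun g => isClosed_closure
  have hB : IsClosed (⋃ g ∈ {g : Bound k n | g ≠ f ∧ ∀ a b, rankMatrix g a b ≤ rankMatrix f a b},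
      positroidVariety g) :=
    (Set.toFinite _).isClosed_biUnion fun g _ => hclosed g
  have : openPositroidVariety f = positroidVariety f ∩
      (⋃ g ∈ {g : Bound k n | g ≠ f ∧ ∀ a b, rankMatrix g a b ≤ rankMatrix f a b},
        positroidVariety g)ᶜ := by
    ext V
    simp only [positroidVariety_eq_setOf_cyclicRank_le hn, Set.mem_inter_iff, Set.mem_ofPred_eq,
      Set.mem_compl_iff, Set.mem_iUnion, not_exists, and_imp]
    constructor
    · intro h
      refine ⟨fun a b => (h a b).le, fun g hne hle hg => hne ?_⟩
      exact Bound.ext_of_rankMatrix hn fun a b => le_antisymm (hle a b) (h a b ▸ hg a b)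
    · rintro ⟨h1, h2⟩
      obtain ⟨g, hg⟩ := exists_mem_openPositroidVariety hn V
      by_cases hgf : g = f
      · exact hgf ▸ hg
      · exact absurd (fun a b => (hg a b).le) (h2 g hgf fun a b => hg a b ▸ h1 a b)
  rw [this]
  exact (hclosed f).isLocallyClosed.inter hB.isOpen_compl.isLocallyClosed

end Varieties

/-! ### Schubert conditions -/

section Schubert

variable {k n : ℕ}

theorem permAct_permAct_symm (σ : Equiv.Perm (Fin n)) (V : Gr k n) :
    permAct σ (permAct σ.symm V) = V := by
  refine Subtype.ext ?_
  simp only [permAct]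
  rw [← Submodule.map_comp]
  convert Submodule.map_id V.1
  ext x c
  simp [LinearEquiv.funCongrLeft]

theorem projDim_permAct (σ : Equiv.Perm (Fin n)) (V : Gr k n) (S : Set (Fin n)) :
    projDim S (permAct σ V) = projDim (σ ⁻¹' S) V := by
  have hV := span_range_basisMatrix V
  have hA : Submodule.span ℂ (Set.range ((basisMatrix V).submatrix id σ.symm)) =
      (permAct σ V).1 := by
    change _ = V.1.map (LinearEquiv.funCongrLeft ℂ ℂ σ.symm).toLinearMap
    rw [← hV, Submodule.map_span]
    exact congrArg (Submodule.span ℂ) (Set.range_comp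
      (LinearEquiv.funCongrLeft ℂ ℂ σ.symm).toLinearMap (basisMatrix V).row)
  rw [projDim_eq_finrank_span hA, projDim_eq_finrank_span hV]
  rw [← Equiv.image_symm_eq_preimage]
  exact congrArg (fun T : Set (Fin k → ℂ) => Module.finrank ℂ (Submodule.span ℂ T))
    (Set.image_comp (basisMatrix V).transpose σ.symm S)

theorem mem_image_permAct_iff (σ : Equiv.Perm (Fin n)) (I : Finset (Fin n)) (V : Gr k n) :
    V ∈ permAct σ '' schubertVariety k I ↔ ∀ j : ℕ, j ≤ n →
      projDim {c : Fin n | ((σ.symm c : Fin n) : ℕ) + 1 ≤ j} V ≤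
        (I.filter fun c : Fin n => (c : ℕ) + 1 ≤ j).card := by
  constructor
  · rintro ⟨U, hU, rfl⟩ j hj
    have := hU j hj
    rw [projDim_permAct]
    simpa using this
  · intro h
    refine ⟨permAct σ.symm V, fun j hj => ?_, permAct_permAct_symm σ V⟩
    rw [projDim_permAct]
    exact h j hj

theorem chi_pow_modEq (m : ℕ) (c : Fin n) :
    ((((chi n) ^ m) c : Fin n) : ℤ) ≡ (c : ℕ) + m [ZMOD n] := by
  induction m with
  | zero => simp [Int.ModEq]
  | succ m ih =>
    rw [pow_succ', Equiv.Perm.mul_apply]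
    refine Int.ModEq.trans ?_ ((ih.add_right 1).trans (by push_cast; rw [add_assoc]))
    generalize ((chi n) ^ m) c = d
    cases n with
    | zero => exact d.elim0
    | succ n =>
      rw [chi, finRotate_apply, Fin.val_add, Fin.val_one']
      refine (Int.natCast_modEq_iff.2 ((Nat.mod_modEq _ _).trans
        ((Nat.mod_modEq 1 (n + 1)).add_left (d : ℕ)))).trans ?_
      push_cast
      rfl

/-- Shifting by `χ^(i-1)` turns the initial segment `[j]` into the cyclic interval `{i, …, i + j -
1}`. -/
theorem setOf_chi_pow_symm {i j : ℕ} (hi : 1 ≤ i) (hj : j ≤ n) :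
    {c : Fin n | ((((chi n) ^ (i - 1)).symm c : Fin n) : ℕ) + 1 ≤ j} =
      {c : Fin n | ∃ m : ℤ, (i : ℤ) ≤ m ∧ m ≤ i + j - 1 ∧ m ≡ ((c : ℕ) : ℤ) + 1 [ZMOD n]} := by
  ext c
  obtain ⟨d, rfl⟩ := ((chi n) ^ (i - 1)).surjective c
  simp only [Set.mem_ofPred_eq, Equiv.symm_apply_apply]
  have h1 : ((((chi n) ^ (i - 1)) d : Fin n) : ℤ) + 1 ≡ (d : ℕ) + i [ZMOD n] := by
    have := (chi_pow_modEq (i - 1) d).add_right 1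
    have e : ((d : ℕ) : ℤ) + (i - 1 : ℕ) + 1 = (d : ℕ) + i := by omega
    rwa [e] at this
  constructor
  · intro h
    exact ⟨(d : ℕ) + i, by omega, by omega, h1.symm⟩
  · rintro ⟨m, h2, h3, h4⟩
    have h5 := (h4.trans h1).sub_right i
    rw [add_sub_cancel_right] at h5
    have h6 : m - i = ((d : ℕ) : ℤ) := by
      have hd := d.2
      rw [Int.ModEq, Int.emod_eq_of_lt (by omega) (by omega),
        Int.emod_eq_of_lt (by omega) (by omega)] at h5
      exact h5
    omega

theorem mem_jugglingSet (f : Bound k n) (i : ℤ) (c : Fin n) :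
    c ∈ jugglingSet f i ↔ ((c : ℕ) : ℤ) + 1 ∈ jugglingState f.1 (i - 1) := by
  unfold jugglingSet
  simp

/-- Both sides vanish at `j = 0` and, passing to `j + 1`, grow by one exactly when the preimage of
`i + j` under `f` is less than `i`. -/
theorem card_filter_jugglingSet (hn : 0 < n) (f : Bound k n) (i : ℤ) (j : ℕ) (hj : j ≤ n) :
    (((jugglingSet f i).filter fun c : Fin n => (c : ℕ) + 1 ≤ j).card : ℤ) =
      rankMatrix f i (i + j - 1) := by
  classical
  induction j with
  | zero =>
    rw [f.rankMatrix_of_lt hn (by simp)]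
    simp
  | succ j ih =>
    have ih := ih (by omega)
    have hmem : (⟨j, by omega⟩ : Fin n) ∈ jugglingSet f i ↔ f.1.symm (i + j) < i := by
      simp only [mem_jugglingSet, jugglingState, Set.mem_ofPred_eq]
      constructor
      · rintro ⟨a, h1, h2⟩
        have : f.1.symm (i + j) = a := by rw [Equiv.symm_apply_eq]; omega
        omega
      · intro h
        refine ⟨f.1.symm (i + j), by omega, ?_⟩
        rw [Equiv.apply_symm_apply]
        ring
    have hcross := ncard_crossings_pred (f.isAffine.finite_crossings hn i (i + j))
    have e : i + ((j + 1 : ℕ) : ℤ) - 1 = i + j := by push_cast; ring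
    rw [Bound.rankMatrix_eq] at ih
    rw [e, Bound.rankMatrix_eq]
    by_cases h : f.1.symm (i + j) < i
    · have hins : (jugglingSet f i).filter (fun c : Fin n => (c : ℕ) + 1 ≤ j + 1) =
          insert ⟨j, by omega⟩ ((jugglingSet f i).filter fun c : Fin n => (c : ℕ) + 1 ≤ j) := by
        ext c
        simp only [Finset.mem_filter, Finset.mem_insert]
        constructor
        · rintro ⟨h1, h2⟩
          by_cases hc : (c : ℕ) = j
          · exact Or.inl (Fin.ext hc)
          · exact Or.inr ⟨h1, by omega⟩
        · rintro (rfl | ⟨h1, h2⟩)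
          · exact ⟨hmem.2 h, le_rfl⟩
          · exact ⟨h1, by omega⟩
      rw [if_pos h] at hcross
      rw [hins, Finset.card_insert_of_notMem (by simp)]
      push_cast
      omega
    · have hsame : (jugglingSet f i).filter (fun c : Fin n => (c : ℕ) + 1 ≤ j + 1) =
          (jugglingSet f i).filter fun c : Fin n => (c : ℕ) + 1 ≤ j := by
        ext c
        simp only [Finset.mem_filter]
        constructor
        · rintro ⟨h1, h2⟩
          refine ⟨h1, ?_⟩
          by_contra hc
          have : c = ⟨j, by omega⟩ := Fin.ext (by simp only; omega)
          exact h (hmem.1 (this ▸ h1))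
        · rintro ⟨h1, h2⟩
          exact ⟨h1, by omega⟩
      rw [if_neg h] at hcross
      rw [hsame]
      omega

theorem positroidVariety_eq_iInter (hn : 0 < n) (f : Bound k n) :
    positroidVariety f = ⋂ i ∈ Finset.Icc 1 n,
      permAct (chi n ^ (i - 1)) '' schubertVariety k (jugglingSet f i) := by
  rw [positroidVariety_eq_setOf_cyclicRank_le hn]
  ext V
  simp only [Set.mem_iInter, mem_image_permAct_iff, Set.mem_ofPred_eq, Finset.mem_Icc]
  constructor
  · rintro h i ⟨hi, -⟩ j hj
    rw [setOf_chi_pow_symm hi hj]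
    have h1 := h i (i + j - 1)
    rw [← card_filter_jugglingSet hn f i j hj] at h1
    -- For `j = 0` the interval is empty and `cyclicRank` is given by its convention, so the
    -- condition is checked directly.
    rcases Nat.eq_zero_or_pos j with rfl | hj0
    · refine (le_of_eq ?_).trans (Nat.zero_le _)
      have : {c : Fin n | ∃ m : ℤ, (i : ℤ) ≤ m ∧ m ≤ i + ((0 : ℕ) : ℤ) - 1 ∧
          m ≡ ((c : ℕ) : ℤ) + 1 [ZMOD n]} = ∅ := by
        ext c
        simp only [Set.mem_ofPred_eq, Set.mem_empty_iff_false, iff_false, not_exists]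
        rintro m ⟨h2, h3, -⟩
        omega
      rw [this, projDim_eq_finrank_span (span_range_basisMatrix V)]
      have hbot : Submodule.span ℂ ((basisMatrix V).transpose '' ∅) = ⊥ :=
        Submodule.span_eq_bot.2 (by rintro _ ⟨c, hc, rfl⟩; exact hc.elim)
      rw [hbot, finrank_bot]
    · rw [cyclicRank, if_neg (by omega)] at h1
      exact_mod_cast h1
  · intro h a b
    -- Using the open variety that contains `V`, its ranks become those of `g`. The bounds for `b <
    -- a` and for full cyclic intervals are then equalities, and periodicity brings the remaining
    -- ones to `1 ≤ i ≤ n`.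
    obtain ⟨g, hg⟩ := exists_mem_openPositroidVariety hn V
    rcases lt_or_ge b a with hba | hba
    · rw [hg, g.rankMatrix_of_lt hn hba, f.rankMatrix_of_lt hn hba]
    rcases le_or_gt (a + n) (b + 1) with hab | hab
    · rw [hg, g.rankMatrix_of_le hab, f.rankMatrix_of_le hab]
    obtain ⟨i, r, h1, h2, rfl⟩ := exists_mem_Icc_add_mul hn a
    lift i to ℕ using (by omega)
    have h3 := h i ⟨by omega, by omega⟩ (b - (i + r * n) + 1).toNat (by omega)
    rw [setOf_chi_pow_symm (by omega) (by omega)] at h3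
    have h4 := card_filter_jugglingSet hn f i (b - (i + r * n) + 1).toNat (by omega)
    have e : (i : ℤ) + ((b - (i + r * n) + 1).toNat : ℤ) - 1 = b - r * n := by omega
    rw [e] at h3 h4
    have h5 : cyclicRank V i (b - r * n) ≤ rankMatrix f i (b - r * n) := by
      rw [← h4, cyclicRank, if_neg (by omega)]
      exact_mod_cast h3
    rw [hg] at h5 ⊢
    rw [← g.rankMatrix_add _ _ r, ← f.rankMatrix_add _ _ r, sub_add_cancel] at h5
    exact h5

end Schubert

end Positroid

theorem theorem5 (k n : ℕ) (hn : 0 < n) (hk : k ≤ n) :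
    Positroid.IsStratification
      (fun f : Positroid.Bound k n => Positroid.openPositroidVariety f) ∧
    ∀ f : Positroid.Bound k n,
      Positroid.positroidVariety f =
          ⋃ f' ∈ {f' : Positroid.Bound k n | Positroid.BruhatLE n f.1 f'.1},
            Positroid.openPositroidVariety f' ∧
      Set.PairwiseDisjoint {f' : Positroid.Bound k n | Positroid.BruhatLE n f.1 f'.1}
        Positroid.openPositroidVariety ∧
      Positroid.positroidVariety f =
        ⋂ i ∈ Finset.Icc 1 n,
          Positroid.permAct (Positroid.chi n ^ (i - 1)) ''
            Positroid.schubertVariety k (Positroid.jugglingSet f i) := by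
  have hdisj : ∀ f g : Positroid.Bound k n, f ≠ g →
      Disjoint (Positroid.openPositroidVariety f) (Positroid.openPositroidVariety g) :=
    fun f g hne => Set.disjoint_left.2 fun V hf hg =>
      hne (Positroid.eq_of_mem_openPositroidVariety hn hf hg)
  refine ⟨⟨Positroid.Bound.finite hn, Positroid.openPositroidVariety_nonempty hn, hdisj, ?_,
    Positroid.isLocallyClosed_openPositroidVariety hn,
    fun f => ⟨_, Positroid.positroidVariety_eq_iUnion hn f⟩⟩,
    fun f => ⟨Positroid.positroidVariety_eq_iUnion hn f, fun g _ g' _ hne => hdisj g g' hne,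
      Positroid.positroidVariety_eq_iInter hn f⟩⟩
  exact Set.eq_univ_of_forall fun V =>
    Set.mem_iUnion.2 (Positroid.exists_mem_openPositroidVariety hn V)
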